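/- Let $A=\bigoplus_{n\ge 0}A_n$ be a commutative Noetherian graded ring such that $A_0$ is an Artinian local ring (for example, a field) and $A$ is generated as an $A_0$-algebra by $A_1$. Let $M\neq 0$ and $N$ be finitely generated $\mathbb{Z}$-graded $A$-modules such that $M$ has finite projective dimension over $A$ and $M\otimes_A N$ has finite length. Then every $\mathrm{Tor}_i^A(M,N)$ has finite length and $\mathrm{Tor}_i^A(M,N)=0$ for all sufficiently large $i$, so that $$\chi(M,N)=\sum_{i\ge 0}(-1)^i\,\mathrm{length}_A\big(\mathrm{Tor}_i^A(M,N)\big)$$ is a well-defined integer, and, writing $\dim$ for Krull dimension (with $\dim 0=-\infty$): 1. $\dim M+\dim N\le\dim A$. 2. $\chi(M,N)\ge 0$. 3. $\chi(M,N)>0$ if and only if $\dim M+\dim N=\dim A$. -/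

import Mathlib

open CategoryTheory TensorProduct

universe u

/-- `𝒜` makes `A` a standard graded ring: `A = ⨁ n ≥ 0, A_n` is Noetherian, `A_0` is an Artinian
local ring (for instance a field), and `A` is generated as an `A_0`-algebra by `A_1`. -/
structure IsStandardGraded {A : Type u} [CommRing A] (𝒜 : ℕ → AddSubgroup A) [GradedRing 𝒜] :
    Prop where
  isNoetherianRing : IsNoetherianRing A
  isArtinianRing_zero : IsArtinianRing (𝒜 0)
  isLocalRing_zero : IsLocalRing (𝒜 0)
  adjoin_one : Algebra.adjoin (𝒜 0) (𝒜 1 : Set A) = ⊤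

/-- The additive subgroups `ℳ j` (`j ∈ ℤ`) make `M` a `ℤ`-graded module over the `ℕ`-graded ring
`A`: `M = ⨁ j, M_j` and `A_i M_j ⊆ M_{i + j}`. -/
structure IsGradedModuleOver {A : Type u} [CommRing A] (𝒜 : ℕ → AddSubgroup A)
    {M : Type u} [AddCommGroup M] [Module A M] (ℳ : ℤ → AddSubgroup M) : Prop where
  isInternal : DirectSum.IsInternal ℳ
  smul_mem : ∀ (i : ℕ) (j : ℤ) (a : A) (m : M), a ∈ 𝒜 i → m ∈ ℳ j → a • m ∈ ℳ ((i : ℤ) + j)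

/-- `M` has finite projective dimension over `A`. -/
def HasFiniteProjDim (A : Type u) [CommRing A] (M : Type u) [AddCommGroup M] [Module A M] : Prop :=
  ∃ n : ℕ, HasProjectiveDimensionLE (ModuleCat.of A M) n

/-- `Tor_i^A(M, N)`, the `i`-th left derived functor of `- ⊗_A N` at `M`, i.e. the `i`-th homology
of `F ⊗_A N` for a projective resolution `F` of `M`. -/
noncomputable abbrev torModule (A : Type u) [CommRing A] (M N : Type u) [AddCommGroup M]
    [Module A M] [AddCommGroup N] [Module A N] (i : ℕ) : ModuleCat.{u} A :=
  ((Tor' (ModuleCat.{u} A) i).obj (ModuleCat.of A M)).obj (ModuleCat.of A N)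

/-- The intersection multiplicity `χ(M, N) = ∑ i, (-1)^i length (Tor_i^A(M, N))`. It is meaningful
when all the `Tor_i` have finite length and almost all of them vanish. -/
noncomputable def intersectionMultiplicity (A : Type u) [CommRing A] (M N : Type u)
    [AddCommGroup M] [Module A M] [AddCommGroup N] [Module A N] : ℤ :=
  ∑ᶠ i : ℕ, (-1 : ℤ) ^ i * ((Module.length A (torModule A M N i)).toNat : ℤ)

/-! The proof compares poles at `t = 1` of Hilbert series. For a finitely generated graded module
`M` let `M_{>D}` be the part in degrees above `D`. It is an `A`-submodule, because `A` lives in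
nonnegative degrees, and `M / M_{>D}` has finite length. The Laurent series `H_M(t) = ∑_D length(M /
M_{>D}) t^D` is additive on graded short exact sequences.

The analytic input is `Gr.poleEqDim`: for `M ≠ 0` the pole of `H_M` at `1` has order `dim M + 1` and
positive leading coefficient. Dévissage reduces this to `A/p` with `p` a homogeneous prime. If `p`
does not contain `A_1`, dividing by some `x ∈ A_1 \ p` multiplies the series by `1 - t` and leads to
larger primes. The bound `dim A/p ≤ pole order - 1` must account for chains of arbitrary primes.
Such a chain of length `k` forces growth at least like a polynomial of degree `k`
(`exists_choose_le_growth`), while the pole bounds the growth from above.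

The algebraic input is a finite graded free resolution `F` of `M`. By a graded Nakayama argument
(`Gr.injective_of_minimal`), minimal generators of a graded projective module form a basis, so the
minimal resolution stops at the projective dimension. If `P(t)` is the alternating sum of `t^deg`
over the generators of `F`, then `H_M = P H_A`. Computing Tor from `F ⊗ N` with gradings
(`GradedModule.exists_torModule_series`) gives `P H_N = ∑ (-1)^i H_{Tor_i}`. Hence `H_M H_N = H_A ∑
(-1)^i H_{Tor_i}`.

A module of finite length has a series with pole of order at most `1` and coefficient its length, so
the last sum has coefficient `χ(M, N)` at order `1`. The left side has order exactly `dim M + dim N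
+ 2` with positive coefficient; on the right, the coefficient at order `dim A + 2` is a positive
multiple of `χ`. All three claims follow (`HasPole.compare`). -/

/-- A `ℤ`-grading on an `A`-module, recorded by its projections onto homogeneous components. -/
structure Gr {A : Type*} [CommRing A] (𝒜 : ℕ → AddSubgroup A) (M : Type*) [AddCommGroup M]
    [Module A M] where
  comp : ℤ → M →+ M
  comp_comp : ∀ i j m, comp i (comp j m) = if i = j then comp j m else 0
  exists_sum : ∀ m, ∃ s : Finset ℤ, ∑ j ∈ s, comp j m = m
  comp_smul : ∀ (i : ℕ) (j : ℤ) (a : A) (m : M), a ∈ 𝒜 i → comp (i + j) (a • m) = a • comp j m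

/-! ### Graded modules: homogeneous maps, submodules, quotients, products. -/

namespace Gr

section Basic

variable {A : Type*} [CommRing A] {𝒜 : ℕ → AddSubgroup A}
variable {M : Type*} [AddCommGroup M] [Module A M] {M' : Type*} [AddCommGroup M'] [Module A M']
  {M'' : Type*} [AddCommGroup M''] [Module A M'']

lemma comp_self (G : Gr 𝒜 M) (i : ℤ) (m : M) : G.comp i (G.comp i m) = G.comp i m := by
  simp [G.comp_comp]

lemma comp_of_ne (G : Gr 𝒜 M) {i j : ℤ} (h : i ≠ j) (m : M) : G.comp i (G.comp j m) = 0 := by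
  simp [G.comp_comp, h]

lemma exists_support (G : Gr 𝒜 M) (m : M) :
    ∃ s : Finset ℤ, (∀ j ∉ s, G.comp j m = 0) ∧ ∑ j ∈ s, G.comp j m = m := by
  obtain ⟨s, hs⟩ := G.exists_sum m
  refine ⟨s, fun j hj => ?_, hs⟩
  rw [← hs, map_sum]
  exact Finset.sum_eq_zero fun i hi => G.comp_of_ne (fun h => hj (by rwa [h])) m

lemma exists_comp_eq_zero (G : Gr 𝒜 M) (m : M) : ∃ E, ∀ j, E < j → G.comp j m = 0 := by
  obtain ⟨s, hs, -⟩ := G.exists_support m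
  obtain ⟨E, hE⟩ := s.bddAbove
  exact ⟨E, fun j hj => hs j fun h => (hE h).not_gt hj⟩

lemma sum_eq (G : Gr 𝒜 M) (m : M) (s : Finset ℤ) (h : ∀ j ∉ s, G.comp j m = 0) :
    ∑ j ∈ s, G.comp j m = m := by
  obtain ⟨t, ht, hs⟩ := G.exists_support m
  conv_rhs => rw [← hs]
  refine Finset.sum_congr_of_eq_on_inter (fun a _ h' => ht a h') (fun a _ h' => h a h')
    (fun _ _ _ => rfl)

lemma eq_zero (G : Gr 𝒜 M) {m : M} (h : ∀ j, G.comp j m = 0) : m = 0 := by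
  obtain ⟨s, hs⟩ := G.exists_sum m
  rw [← hs]; exact Finset.sum_eq_zero fun i _ => h i

lemma comp_smul' (G : Gr 𝒜 M) {i : ℕ} {a : A} (ha : a ∈ 𝒜 i) (j : ℤ) (m : M) :
    G.comp j (a • m) = a • G.comp (j - i) m := by
  rw [← G.comp_smul i _ a m ha]; congr 2; ring

/-- A linear map preserving degrees. -/
def IsHom (G : Gr 𝒜 M) (G' : Gr 𝒜 M') (f : M →ₗ[A] M') : Prop :=
  ∀ j m, G'.comp j (f m) = f (G.comp j m)

lemma IsHom.comp {G : Gr 𝒜 M} {G' : Gr 𝒜 M'} {G'' : Gr 𝒜 M''} {f : M →ₗ[A] M'}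
    {g : M' →ₗ[A] M''} (hg : IsHom G' G'' g) (hf : IsHom G G' f) : IsHom G G'' (g ∘ₗ f) :=
  fun j m => by simp [hg j, hf j]

lemma isHom_zero (G : Gr 𝒜 M) (G' : Gr 𝒜 M') : IsHom G G' 0 := fun j m => by simp

/-- The grading with degrees lowered by `n`. -/
@[simps] def shift (G : Gr 𝒜 M) (n : ℤ) : Gr 𝒜 M where
  comp j := G.comp (j + n)
  comp_comp i j m := by simp [G.comp_comp]
  exists_sum m := by
    obtain ⟨s, hs⟩ := G.exists_sum m
    refine ⟨s.map (Equiv.subRight n).toEmbedding, ?_⟩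
    simpa [Finset.sum_map] using hs
  comp_smul i j a m ha := by rw [add_assoc]; exact G.comp_smul i _ a m ha

/-- A submodule containing the homogeneous components of its elements. -/
def IsHomogeneous (G : Gr 𝒜 M) (U : Submodule A M) : Prop := ∀ j m, m ∈ U → G.comp j m ∈ U

lemma IsHom.isHomogeneous_ker {G : Gr 𝒜 M} {G' : Gr 𝒜 M'} {f : M →ₗ[A] M'} (hf : IsHom G G' f) :
    G.IsHomogeneous (LinearMap.ker f) := fun j m hm => by
  rw [LinearMap.mem_ker] at *; rw [← hf, hm, map_zero]

lemma IsHom.isHomogeneous_range {G : Gr 𝒜 M} {G' : Gr 𝒜 M'} {f : M →ₗ[A] M'}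
    (hf : IsHom G G' f) : G'.IsHomogeneous (LinearMap.range f) := by
  rintro j _ ⟨m, rfl⟩; exact ⟨_, (hf j m).symm⟩

/-- The grading of a homogeneous submodule. -/
@[simps] def sub (G : Gr 𝒜 M) (U : Submodule A M) (hU : G.IsHomogeneous U) : Gr 𝒜 U where
  comp j := ((G.comp j).comp U.subtype.toAddMonoidHom).codRestrict U (fun m => hU j _ m.2)
  comp_comp i j m := by
    ext; simp only [AddMonoidHom.codRestrict_apply]
    split_ifs with h <;> simp [G.comp_comp, h]
  exists_sum m := by
    obtain ⟨s, hs⟩ := G.exists_sum m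
    exact ⟨s, by ext; simpa using hs⟩
  comp_smul i j a m ha := by ext; simpa using G.comp_smul i j a m ha

lemma sub_isHom (G : Gr 𝒜 M) (U : Submodule A M) (hU : G.IsHomogeneous U) :
    IsHom (G.sub U hU) G U.subtype := fun _ _ => rfl

/-- The grading of the quotient by a homogeneous submodule. -/
def quot (G : Gr 𝒜 M) (U : Submodule A M) (hU : G.IsHomogeneous U) : Gr 𝒜 (M ⧸ U) where
  comp j := QuotientAddGroup.map U.toAddSubgroup U.toAddSubgroup (G.comp j) (fun m hm => hU j m hm)
  comp_comp i j m := by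
    induction m using Submodule.Quotient.induction_on with | _ m
    change Submodule.Quotient.mk _ = _
    rw [G.comp_comp]
    split_ifs with h <;> rfl
  exists_sum m := by
    induction m using Submodule.Quotient.induction_on with | _ m
    obtain ⟨s, hs⟩ := G.exists_sum m
    refine ⟨s, ?_⟩
    conv_rhs => rw [← hs]
    exact (map_sum U.mkQ _ _).symm
  comp_smul i j a m ha := by
    induction m using Submodule.Quotient.induction_on with | _ m
    exact congrArg U.mkQ (G.comp_smul i j a m ha)

lemma quot_isHom (G : Gr 𝒜 M) (U : Submodule A M) (hU : G.IsHomogeneous U) :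
    IsHom G (G.quot U hU) U.mkQ := fun _ _ => rfl

/-- The grading of a finite product. -/
@[simps] def pi {ι : Type*} [Fintype ι] {N : ι → Type*} [∀ k, AddCommGroup (N k)]
    [∀ k, Module A (N k)] (G : ∀ k, Gr 𝒜 (N k)) : Gr 𝒜 (∀ k, N k) where
  comp j := AddMonoidHom.mk' (fun v k => (G k).comp j (v k)) (fun v w => by ext; simp)
  comp_comp i j v := by
    split_ifs with h <;> ext k <;> simp [(G k).comp_comp, h]
  exists_sum v := by
    classical
    choose s h hs using fun k => (G k).exists_support (v k)
    refine ⟨Finset.univ.biUnion s, ?_⟩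
    ext k
    rw [Finset.sum_apply]
    exact (G k).sum_eq _ _ fun j hj => h k j fun h' => hj (Finset.mem_biUnion.2 ⟨k, by simp, h'⟩)
  comp_smul i j a v ha := by ext k; exact (G k).comp_smul i j a _ ha

/-- Transport of a grading along a linear equivalence. -/
@[simps] def congr (G : Gr 𝒜 M) (e : M ≃ₗ[A] M') : Gr 𝒜 M' where
  comp j := (e.toLinearMap.toAddMonoidHom.comp (G.comp j)).comp e.symm.toLinearMap.toAddMonoidHom
  comp_comp i j m := by
    split_ifs with h <;> simp [G.comp_comp, h]
  exists_sum m := by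
    obtain ⟨s, hs⟩ := G.exists_sum (e.symm m)
    refine ⟨s, ?_⟩
    simpa [-map_sum, ← map_sum] using congrArg e hs
  comp_smul i j a m ha := by simp [G.comp_smul i j a _ ha]

lemma tensor_induction {N : Type*} [AddCommGroup N] [Module A N] (G : Gr 𝒜 M) (H : Gr 𝒜 N)
  {p : M ⊗[A] N → Prop} (h0 : p 0)
    (h1 : ∀ i j m n, p (G.comp i m ⊗ₜ H.comp j n)) (h2 : ∀ x y, p x → p y → p (x + y))
    (x : M ⊗[A] N) : p x := by
  have hsum : ∀ {ι : Type} (s : Finset ι) (f : ι → M ⊗[A] N), (∀ i ∈ s, p (f i)) →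
      p (∑ i ∈ s, f i) := fun s f h => Finset.sum_induction f p h2 h0 h
  induction x with
  | zero => exact h0
  | add x y hx hy => exact h2 x y hx hy
  | tmul m n =>
    obtain ⟨s, hs⟩ := G.exists_sum m
    obtain ⟨t, ht⟩ := H.exists_sum n
    rw [← hs, ← ht, TensorProduct.sum_tmul]
    refine hsum _ _ fun i _ => ?_
    rw [TensorProduct.tmul_sum]
    exact hsum _ _ fun j _ => h1 _ _ _ _

end Basic

/-! ### Gradings on tensor products, on the ring, and from families of subgroups. -/

section Tensor

variable {A : Type*} [CommRing A] {𝒜 : ℕ → AddSubgroup A} [GradedRing 𝒜]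
variable {M : Type*} [AddCommGroup M] [Module A M] {M' : Type*} [AddCommGroup M'] [Module A M']
  {N : Type*} [AddCommGroup N] [Module A N]

/-- The bounded part `m ⊗ n ↦ ∑ i, m_i ⊗ n_{d-i}` of the tensor grading. -/
noncomputable def tensorComp (G : Gr 𝒜 M) (H : Gr 𝒜 N) (d : ℤ) : M ⊗[A] N →+ M ⊗[A] N :=
  have key (m : M) (n : N) (s : Finset ℤ) (hs : ∀ j ∉ s, G.comp j m = 0) :
      ∑ᶠ i, G.comp i m ⊗ₜ[A] H.comp (d - i) n = ∑ i ∈ s, G.comp i m ⊗ₜ[A] H.comp (d - i) n :=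
    finsum_eq_sum_of_support_subset _ fun i hi => by
      by_contra h
      exact hi (by simp [hs i h])
  have fin (m : M) (n : N) :
      (Function.support fun i => G.comp i m ⊗ₜ[A] H.comp (d - i) n).Finite := by
    obtain ⟨s, hs, -⟩ := G.exists_support m
    exact s.finite_toSet.subset fun i hi => by
      by_contra h
      exact hi (by simp [hs i h])
  TensorProduct.liftAddHom
    (AddMonoidHom.mk' (fun m => AddMonoidHom.mk'
      (fun n => ∑ᶠ i, G.comp i m ⊗ₜ[A] H.comp (d - i) n)
      (fun n n' => by
        simp only [map_add, TensorProduct.tmul_add]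
        exact finsum_add_distrib (fin _ _) (fin _ _)))
      (fun m m' => by
        ext n
        simp only [map_add, TensorProduct.add_tmul, AddMonoidHom.mk'_apply, AddMonoidHom.add_apply]
        exact finsum_add_distrib (fin _ _) (fin _ _)))
    (fun r m n => by
      simp only [AddMonoidHom.mk'_apply]
      -- The formula is balanced over `A`: moving a homogeneous scalar of degree `i` across the
      -- tensor sign only translates the summation index by `i`.
      induction r using DirectSum.Decomposition.inductionOn 𝒜 with
      | zero => simp
      | @homogeneous i a =>
        simp only [G.comp_smul' a.2, H.comp_smul' a.2]
        rw [← finsum_comp_equiv (Equiv.subRight (i : ℤ))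
          (f := fun j => G.comp j m ⊗ₜ[A] ((a : A) • H.comp (d - j - i) n))]
        refine finsum_congr fun j => ?_
        simp only [Equiv.subRight_apply, TensorProduct.smul_tmul]
        congr 4; ring
      | add a b ha hb =>
        simp only [add_smul, map_add, TensorProduct.add_tmul, TensorProduct.tmul_add] at *
        rw [finsum_add_distrib (fin _ _) (fin _ _), ha, hb,
          finsum_add_distrib (fin _ _) (fin _ _)])

lemma tensorComp_tmul (G : Gr 𝒜 M) (H : Gr 𝒜 N) (d : ℤ) (m : M) (n : N) :
    tensorComp G H d (m ⊗ₜ n) = ∑ᶠ i, G.comp i m ⊗ₜ[A] H.comp (d - i) n := rfl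

lemma tensorComp_homogeneous (G : Gr 𝒜 M) (H : Gr 𝒜 N) (d i j : ℤ) (m : M) (n : N) :
    tensorComp G H d (G.comp i m ⊗ₜ H.comp j n) =
      if d = i + j then G.comp i m ⊗ₜ H.comp j n else 0 := by
  rw [tensorComp_tmul, finsum_eq_single _ i]
  · by_cases h : d = i + j
    · simp [h, G.comp_self, H.comp_self]
    · rw [if_neg h, H.comp_of_ne (by omega), TensorProduct.tmul_zero]
  · intro k hk
    rw [G.comp_of_ne hk, TensorProduct.zero_tmul]

/-- The grading of a tensor product. -/
noncomputable def tensor (G : Gr 𝒜 M) (H : Gr 𝒜 N) : Gr 𝒜 (M ⊗[A] N) where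
  comp := tensorComp G H
  comp_comp i j x := by
    induction x using tensor_induction G H with
    | h0 => simp
    | h1 k l m n =>
      rw [tensorComp_homogeneous]
      by_cases h : j = k + l
      · rw [if_pos h, tensorComp_homogeneous, h]
      · simp [if_neg h]
    | h2 x y hx hy =>
      rw [map_add, map_add, hx, hy]; split_ifs <;> simp
  exists_sum x := by
    classical
    have key : ∀ y : M ⊗[A] N, ∃ s : Finset ℤ, ∀ t, s ⊆ t → ∑ j ∈ t, tensorComp G H j y = y := by
      intro y
      induction y using tensor_induction G H with
      | h0 => exact ⟨∅, by simp⟩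
      | h1 k l m n =>
        refine ⟨{k + l}, fun t ht => ?_⟩
        simp only [tensorComp_homogeneous]
        rw [Finset.sum_ite_eq' t, if_pos (ht (by simp))]
      | h2 x y hx hy =>
        obtain ⟨s, hs⟩ := hx
        obtain ⟨t, ht⟩ := hy
        refine ⟨s ∪ t, fun r hr => ?_⟩
        simp only [map_add, Finset.sum_add_distrib]
        rw [hs r (Finset.union_subset_left hr), ht r (Finset.union_subset_right hr)]
    obtain ⟨s, hs⟩ := key x
    exact ⟨s, hs s subset_rfl⟩
  comp_smul i j a x ha := by
    induction x using tensor_induction G H with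
    | h0 => simp
    | h1 k l m n =>
      rw [TensorProduct.smul_tmul', ← G.comp_smul i k a m ha, tensorComp_homogeneous,
        tensorComp_homogeneous]
      by_cases h : j = k + l
      · rw [if_pos h, if_pos (by omega), TensorProduct.smul_tmul', G.comp_smul i k a m ha]
      · rw [if_neg h, if_neg (by omega), smul_zero]
    | h2 x y hx hy => rw [smul_add, map_add, map_add, hx, hy, smul_add]

lemma tensor_comp_tmul (G : Gr 𝒜 M) (H : Gr 𝒜 N) (d i j : ℤ) (m : M) (n : N) :
    (tensor G H).comp d (G.comp i m ⊗ₜ H.comp j n) =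
      if d = i + j then G.comp i m ⊗ₜ H.comp j n else 0 := tensorComp_homogeneous G H d i j m n

lemma IsHom.rTensor {G : Gr 𝒜 M} {G' : Gr 𝒜 M'} {f : M →ₗ[A] M'} (hf : IsHom G G' f)
    (H : Gr 𝒜 N) : IsHom (tensor G H) (tensor G' H) (f.rTensor N) := by
  intro d x
  induction x using tensor_induction G H with
  | h0 => simp
  | h1 k l m n =>
    rw [LinearMap.rTensor_tmul, ← hf, tensor_comp_tmul, tensor_comp_tmul]
    split_ifs
    · rw [hf, LinearMap.rTensor_tmul]
    · simp
  | h2 x y hx hy => simp only [map_add, hx, hy]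

end Tensor

section Self

variable {A : Type*} [CommRing A] (𝒜 : ℕ → AddSubgroup A) [GradedRing 𝒜]

/-- The ring as a graded module over itself. -/
def self : Gr 𝒜 A where
  comp j := if 0 ≤ j then GradedRing.proj 𝒜 j.toNat else 0
  comp_comp i j a := by
    by_cases hj : 0 ≤ j
    · by_cases hi : 0 ≤ i
      · rw [if_pos hj, if_pos hi, GradedRing.proj_apply, GradedRing.proj_apply]
        split_ifs with h
        · rw [h, DirectSum.decompose_of_mem_same _ (SetLike.coe_mem _)]
        · rw [DirectSum.decompose_of_mem_ne _ (SetLike.coe_mem _) (by omega)]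
      · rw [if_pos hj, if_neg hi, if_neg (by rintro rfl; exact hi hj)]; rfl
    · rw [if_neg hj]; simp
  exists_sum a := by
    classical
    refine ⟨(DirectSum.decompose 𝒜 a).support.map Nat.castEmbedding, ?_⟩
    rw [Finset.sum_map]
    conv_rhs => rw [← DirectSum.sum_support_decompose 𝒜 a]
    refine Finset.sum_congr rfl fun i _ => ?_
    simp [GradedRing.proj_apply]
  comp_smul i j a b ha := by
    by_cases hj : 0 ≤ j
    · rw [if_pos hj, if_pos (by omega), show ((i : ℤ) + j).toNat = i + j.toNat by omega]
      simp only [GradedRing.proj_apply, smul_eq_mul]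
      exact DirectSum.coe_decompose_mul_add_of_left_mem 𝒜 ha
    · rw [if_neg hj]
      by_cases h : 0 ≤ i + j
      · rw [if_pos h]
        simp only [GradedRing.proj_apply, smul_eq_mul]
        rw [DirectSum.coe_decompose_mul_of_left_mem_of_not_le 𝒜 ha (by omega)]; simp
      · rw [if_neg h]; simp

lemma self_comp_natCast (i : ℕ) (a : A) : (self 𝒜).comp i a = DirectSum.decompose 𝒜 a i := by
  simp [self, GradedRing.proj_apply]

lemma self_comp_of_neg {j : ℤ} (hj : j < 0) (a : A) : (self 𝒜).comp j a = 0 := by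
  simp [self, hj.not_ge]

end Self

section OfGraded

variable {A : Type u} [CommRing A] {𝒜 : ℕ → AddSubgroup A}

lemma nonempty_of_isGradedModuleOver {M : Type u} [AddCommGroup M] [Module A M]
    {ℳ : ℤ → AddSubgroup M} (h : IsGradedModuleOver 𝒜 ℳ) : Nonempty (Gr 𝒜 M) := by
  classical
  let : DirectSum.Decomposition ℳ := h.isInternal.chooseDecomposition
  refine ⟨⟨fun j => (ℳ j).subtype.comp ((DFinsupp.evalAddMonoidHom j).comp
    (DirectSum.decomposeAddEquiv ℳ).toAddMonoidHom), ?_, ?_, ?_⟩⟩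
  · intro i j m
    change (DirectSum.decompose ℳ (DirectSum.decompose ℳ m j : M) i : M) =
      if i = j then (DirectSum.decompose ℳ m j : M) else 0
    split_ifs with h
    · rw [h, DirectSum.decompose_of_mem_same _ (SetLike.coe_mem _)]
    · rw [DirectSum.decompose_of_mem_ne _ (SetLike.coe_mem _) (by omega)]
  · intro m
    exact ⟨_, DirectSum.sum_support_decompose ℳ m⟩
  · intro i j a m ha
    change (DirectSum.decompose ℳ (a • m) (i + j) : M) = a • (DirectSum.decompose ℳ m j : M)
    induction m using DirectSum.Decomposition.inductionOn ℳ with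
    | zero => simp
    | @homogeneous k m =>
      have h1 := h.smul_mem i k a m ha m.2
      by_cases hk : k = j
      · subst hk
        rw [DirectSum.decompose_of_mem_same _ h1, DirectSum.decompose_of_mem_same _ m.2]
      · rw [DirectSum.decompose_of_mem_ne _ h1 (by omega),
          DirectSum.decompose_of_mem_ne _ m.2 hk, smul_zero]
    | add x y hx hy =>
      rw [smul_add, DirectSum.decompose_add, DirectSum.decompose_add]
      simp only [DirectSum.add_apply, AddSubgroup.coe_add, hx, hy, smul_add]

end OfGraded

end Gr

/-! ### Finite length and the irrelevant ideal. -/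

/-- The ring modulo the annihilator is Noetherian of dimension zero, hence Artinian, and finite
modules over it have finite length. -/
lemma isFiniteLength_of_forall_isMaximal {A X : Type*} [CommRing A] [IsNoetherianRing A]
    [AddCommGroup X] [Module A X] [Module.Finite A X]
    (h : ∀ P : Ideal A, P.IsPrime → Module.annihilator A X ≤ P → P.IsMaximal) :
    IsFiniteLength A X := by
  have : Ring.KrullDimLE 0 (A ⧸ Module.annihilator A X) := by
    refine Ring.KrullDimLE.mk₀ fun I hI => ?_
    have hc : (I.comap (Ideal.Quotient.mk (Module.annihilator A X))).IsMaximal :=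
      h _ inferInstance (by
        conv_lhs => rw [← Ideal.mk_ker (I := Module.annihilator A X)]
        exact Ideal.ker_le_comap _)
    rw [← Ideal.map_comap_of_surjective _ Ideal.Quotient.mk_surjective I]
    refine (Ideal.map_eq_top_or_isMaximal_of_surjective _ Ideal.Quotient.mk_surjective
      hc).resolve_left ?_
    rw [Ideal.map_comap_of_surjective _ Ideal.Quotient.mk_surjective I]
    exact hI.ne_top
  have : IsArtinianRing (A ⧸ Module.annihilator A X) :=
    isArtinianRing_iff_isNoetherianRing_krullDimLE_zero.2 ⟨inferInstance, this⟩
  let := Module.quotientAnnihilator (R := A) (M := X)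
  have : IsScalarTower A (A ⧸ Module.annihilator A X) X :=
    Module.IsTorsionBySet.isScalarTower (Module.isTorsionBySet_annihilator A X)
  have : Module.Finite (A ⧸ Module.annihilator A X) X :=
    Module.Finite.of_restrictScalars_finite A _ _
  rw [← Module.length_ne_top_iff, Module.length_eq_of_surjective (S := A) (R :=
    A ⧸ Module.annihilator A X)
    Ideal.Quotient.mk_surjective]
  exact Module.length_ne_top

namespace IsStandardGraded

variable {A : Type u} [CommRing A] {𝒜 : ℕ → AddSubgroup A} [GradedRing 𝒜]

lemma exists_sub_mem (hA : IsStandardGraded 𝒜) (P : Ideal A) (hP : (𝒜 1 : Set A) ⊆ P) (a : A) :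
    ∃ b : 𝒜 0, a - b ∈ P := by
  have ha : a ∈ Algebra.adjoin (𝒜 0) (𝒜 1 : Set A) := by rw [hA.adjoin_one]; trivial
  induction ha using Algebra.adjoin_induction with
  | mem x hx => exact ⟨0, by simpa using hP hx⟩
  | algebraMap r => exact ⟨r, by simp [show algebraMap (𝒜 0) A r = r from rfl]⟩
  | add x y _ _ hx hy =>
    obtain ⟨b, hb⟩ := hx
    obtain ⟨c, hc⟩ := hy
    refine ⟨b + c, ?_⟩
    have := P.add_mem hb hc
    rwa [sub_add_sub_comm] at this
  | mul x y _ _ hx hy =>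
    obtain ⟨b, hb⟩ := hx
    obtain ⟨c, hc⟩ := hy
    refine ⟨b * c, ?_⟩
    have := P.add_mem (P.mul_mem_right y hb) (P.mul_mem_left (b : A) hc)
    convert this using 1
    rw [SetLike.GradeZero.coe_mul]; ring

/-- Modulo such a `P` only degree zero survives, so `A ⧸ P` is a domain that is a quotient of the
Artinian ring `A_0`, hence a field. -/
lemma isMaximal_of_one_le (hA : IsStandardGraded 𝒜) (P : Ideal A) [P.IsPrime]
    (hP : (𝒜 1 : Set A) ⊆ P) : P.IsMaximal := by
  have := hA.isArtinianRing_zero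
  set f : 𝒜 0 →+* A ⧸ P := (Ideal.Quotient.mk P).comp (algebraMap (𝒜 0) A) with hf
  have hsurj : Function.Surjective f := fun y => by
    obtain ⟨a, rfl⟩ := Ideal.Quotient.mk_surjective y
    obtain ⟨b, hb⟩ := hA.exists_sub_mem P hP a
    exact ⟨b, (Ideal.Quotient.eq.2 hb).symm⟩
  have hk : (RingHom.ker f).IsPrime := RingHom.ker_isPrime f
  have : (RingHom.ker f).IsMaximal := inferInstance
  have hF : IsField (𝒜 0 ⧸ RingHom.ker f) :=
    (Ideal.Quotient.maximal_ideal_iff_isField_quotient _).1 this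
  exact Ideal.Quotient.maximal_of_isField P
    (MulEquiv.isField hF (RingHom.quotientKerEquivOfSurjective hsurj).symm.toMulEquiv)

end IsStandardGraded

/-! ### Cumulative Hilbert functions and their generating series. -/

namespace Gr

variable {A : Type u} [CommRing A] {𝒜 : ℕ → AddSubgroup A} [GradedRing 𝒜]
variable {M : Type*} [AddCommGroup M] [Module A M] {M' : Type*} [AddCommGroup M'] [Module A M']
  {M'' : Type*} [AddCommGroup M''] [Module A M'']

/-- The submodule of elements all of whose components have degree greater than `D`. -/
def above (G : Gr 𝒜 M) (D : ℤ) : Submodule A M where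
  carrier := {m | ∀ j ≤ D, G.comp j m = 0}
  add_mem' ha hb j hj := by rw [map_add, ha j hj, hb j hj, add_zero]
  zero_mem' j _ := map_zero _
  smul_mem' r m hm := by
    induction r using DirectSum.Decomposition.inductionOn 𝒜 with
    | zero => intro j _; simp
    | @homogeneous i a => intro j hj; rw [G.comp_smul' a.2, hm _ (by omega), smul_zero]
    | add a b ha hb => intro j hj; rw [add_smul, map_add, ha j hj, hb j hj, add_zero]

lemma mem_above {G : Gr 𝒜 M} {D : ℤ} {m : M} : m ∈ G.above D ↔ ∀ j ≤ D, G.comp j m = 0 := Iff.rfl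

lemma above_antitone (G : Gr 𝒜 M) : Antitone G.above := fun _ _ h _ hm j hj => hm j (hj.trans h)

lemma shift_above (G : Gr 𝒜 M) (n D : ℤ) : (G.shift n).above D = G.above (D + n) := by
  ext m
  simp only [mem_above, shift_comp]
  exact ⟨fun h j hj => by simpa using h (j - n) (by omega), fun h j hj => h _ (by omega)⟩

lemma exists_add_above (G : Gr 𝒜 M) (D : ℤ) (m : M) :
    ∃ l, ∃ u ∈ G.above D, m = l + u ∧ ∀ j, D < j → G.comp j l = 0 := by
  obtain ⟨s, -, hs⟩ := G.exists_support m
  refine ⟨∑ j ∈ s with j ≤ D, G.comp j m, ∑ j ∈ s with ¬ j ≤ D, G.comp j m, ?_, ?_, ?_⟩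
  · intro j hj
    rw [map_sum]
    refine Finset.sum_eq_zero fun i hi => G.comp_of_ne ?_ m
    have := (Finset.mem_filter.1 hi).2
    omega
  · rw [Finset.sum_filter_add_sum_filter_not, hs]
  · intro j hj
    rw [map_sum]
    refine Finset.sum_eq_zero fun i hi => G.comp_of_ne ?_ m
    have := (Finset.mem_filter.1 hi).2
    omega

lemma IsHom.above_le_comap {G : Gr 𝒜 M} {G' : Gr 𝒜 M'} {f : M →ₗ[A] M'} (hf : IsHom G G' f)
    (D : ℤ) : G.above D ≤ (G'.above D).comap f := fun m hm j hj => by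
  rw [hf, hm j hj, map_zero]

/-- Homogeneous maps are strict for the filtration by degree. -/
lemma IsHom.exists_mem_above {G : Gr 𝒜 M} {G' : Gr 𝒜 M'} {f : M →ₗ[A] M'} (hf : IsHom G G' f)
    {D : ℤ} {m : M} (hm : f m ∈ G'.above D) :
    ∃ l, ∃ u ∈ G.above D, m = l + u ∧ f l = 0 := by
  obtain ⟨l, u, hu, rfl, hl⟩ := G.exists_add_above D m
  -- `f l` lives in degrees at most `D` and `f u` in degrees above `D`; as their sum has no
  -- component in degrees at most `D`, `f l` vanishes.
  refine ⟨l, u, hu, rfl, G'.eq_zero fun j => ?_⟩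
  rcases le_or_gt j D with hj | hj
  · have := hm j hj
    rwa [map_add, map_add, hf j u, hu j hj, map_zero, add_zero] at this
  · rw [hf, hl j hj, map_zero]

/-- Truncation by degree is exact because homogeneous maps are strict: an element whose image has
only high degrees is a kernel element plus an element of high degree. -/
lemma length_quotient_above (G' : Gr 𝒜 M') (G : Gr 𝒜 M) (G'' : Gr 𝒜 M'') {f : M' →ₗ[A] M}
    {g : M →ₗ[A] M''} (hf : IsHom G' G f) (hg : IsHom G G'' g) (hinj : Function.Injective f)
    (hex : Function.Exact f g) (hsurj : Function.Surjective g) (D : ℤ) :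
    Module.length A (M ⧸ G.above D) =
      Module.length A (M' ⧸ G'.above D) + Module.length A (M'' ⧸ G''.above D) := by
  refine Module.length_eq_add_of_exact (Submodule.mapQ _ _ f (hf.above_le_comap D))
    (Submodule.mapQ _ _ g (hg.above_le_comap D)) ?_ ?_ ?_
  · rw [← LinearMap.ker_eq_bot, LinearMap.ker_eq_bot']
    intro x hx
    obtain ⟨m, rfl⟩ := Submodule.Quotient.mk_surjective _ x
    rw [Submodule.mapQ_apply, Submodule.Quotient.mk_eq_zero] at hx
    rw [Submodule.Quotient.mk_eq_zero]
    intro j hj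
    apply hinj
    rw [← hf, hx j hj, map_zero]
  · intro y
    obtain ⟨m, rfl⟩ := Submodule.Quotient.mk_surjective _ y
    obtain ⟨m, rfl⟩ := hsurj m
    exact ⟨Submodule.Quotient.mk m, rfl⟩
  · intro x
    obtain ⟨m, rfl⟩ := Submodule.Quotient.mk_surjective _ x
    rw [Submodule.mapQ_apply, Submodule.Quotient.mk_eq_zero]
    constructor
    · intro hm
      obtain ⟨l, u, hu, rfl, hl⟩ := hg.exists_mem_above hm
      obtain ⟨k, rfl⟩ := (hex _).1 hl
      refine ⟨Submodule.Quotient.mk k, ?_⟩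
      rw [Submodule.mapQ_apply, Submodule.Quotient.eq]
      simpa using (G.above D).neg_mem hu
    · rintro ⟨y, hy⟩
      obtain ⟨k, rfl⟩ := Submodule.Quotient.mk_surjective _ y
      rw [Submodule.mapQ_apply, Submodule.Quotient.eq] at hy
      have := hg.above_le_comap D hy
      rwa [Submodule.mem_comap, map_sub, (hex _).2 ⟨k, rfl⟩, zero_sub, Submodule.neg_mem_iff]
        at this

lemma length_quotient_above_congr (G : Gr 𝒜 M) (G' : Gr 𝒜 M') (e : M ≃ₗ[A] M')
    (he : IsHom G G' e) (D : ℤ) :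
    Module.length A (M ⧸ G.above D) = Module.length A (M' ⧸ G'.above D) := by
  refine LinearEquiv.length_eq (Submodule.Quotient.equiv _ _ e ?_)
  refine le_antisymm (Submodule.map_le_iff_le_comap.2 (he.above_le_comap D)) fun m hm => ?_
  refine ⟨e.symm m, fun j hj => e.injective ?_, by simp⟩
  have := he j (e.symm m)
  simp only [LinearEquiv.coe_coe, e.apply_symm_apply] at this
  rw [← this, hm j hj, map_zero]

lemma exists_above_eq_top (G : Gr 𝒜 M) [Module.Finite A M] : ∃ a, G.above a = ⊤ := by
  obtain ⟨S, hS⟩ := Module.Finite.fg_top (R := A) (M := M)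
  choose s hs _ using G.exists_support
  obtain ⟨a, ha⟩ := (S.biUnion s).bddBelow
  refine ⟨a - 1, ?_⟩
  rw [eq_top_iff, ← hS, Submodule.span_le]
  intro m hm j hj
  refine hs m j fun h => ?_
  have := ha (Finset.mem_coe.2 (Finset.mem_biUnion.2 ⟨m, hm, h⟩))
  omega

lemma exists_forall_above_eq_top (G : Gr 𝒜 M) [Module.Finite A M] :
    ∃ a, ∀ D ≤ a, G.above D = ⊤ := by
  obtain ⟨a, ha⟩ := G.exists_above_eq_top
  exact ⟨a, fun D hD => top_le_iff.1 (ha ▸ G.above_antitone hD)⟩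

lemma pow_smul_mem_above (G : Gr 𝒜 M) {x : A} (hx : x ∈ 𝒜 1) {a : ℤ} (ha : G.above a = ⊤)
    {D : ℤ} {n : ℕ} (hn : D - n ≤ a) (m : M) : x ^ n • m ∈ G.above D := by
  intro j hj
  have hxn : x ^ n ∈ 𝒜 n := by simpa using SetLike.pow_mem_graded n hx
  have hm : m ∈ G.above a := by rw [ha]; trivial
  rw [G.comp_smul' hxn, hm _ (by omega), smul_zero]

/-- Degrees of `M` are bounded below, so each element of `A_1` acts nilpotently on the truncation.
Every prime over its annihilator then contains `A_1` and is maximal. -/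
lemma isFiniteLength_quotient_above (hA : IsStandardGraded 𝒜) (G : Gr 𝒜 M) [Module.Finite A M]
    (D : ℤ) : IsFiniteLength A (M ⧸ G.above D) := by
  have := hA.isNoetherianRing
  refine isFiniteLength_of_forall_isMaximal fun P hP h => hA.isMaximal_of_one_le P fun x hx => ?_
  obtain ⟨a, ha⟩ := G.exists_above_eq_top
  refine hP.mem_of_pow_mem (D - a).toNat (h ?_)
  rw [Module.mem_annihilator]
  intro m
  obtain ⟨m, rfl⟩ := Submodule.Quotient.mk_surjective _ m
  rw [← Submodule.Quotient.mk_smul, Submodule.Quotient.mk_eq_zero]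
  exact G.pow_smul_mem_above hx ha (by omega) m

/-- The length of the part of `M` in degrees at most `D`. -/
noncomputable def hilb (G : Gr 𝒜 M) (D : ℤ) : ℕ := (Module.length A (M ⧸ G.above D)).toNat

lemma natCast_hilb (hA : IsStandardGraded 𝒜) (G : Gr 𝒜 M) [Module.Finite A M] (D : ℤ) :
    (G.hilb D : ℕ∞) = Module.length A (M ⧸ G.above D) :=
  ENat.natCast_toNat_eq_self.2 (Module.length_ne_top_iff.2 (G.isFiniteLength_quotient_above hA D))

lemma hilb_exact (hA : IsStandardGraded 𝒜) (G' : Gr 𝒜 M') (G : Gr 𝒜 M) (G'' : Gr 𝒜 M'')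
    {f : M' →ₗ[A] M} {g : M →ₗ[A] M''} [Module.Finite A M'] [Module.Finite A M]
    [Module.Finite A M''] (hf : IsHom G' G f) (hg : IsHom G G'' g) (hinj : Function.Injective f)
    (hex : Function.Exact f g) (hsurj : Function.Surjective g) (D : ℤ) :
    G.hilb D = G'.hilb D + G''.hilb D := by
  have := length_quotient_above G' G G'' hf hg hinj hex hsurj D
  rw [← natCast_hilb hA, ← natCast_hilb hA, ← natCast_hilb hA] at this
  exact_mod_cast this

lemma hilb_congr (G : Gr 𝒜 M) (G' : Gr 𝒜 M') (e : M ≃ₗ[A] M') (he : IsHom G G' e) (D : ℤ) :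
    G.hilb D = G'.hilb D := by
  rw [hilb, hilb, length_quotient_above_congr G G' e he]

lemma hilb_shift (G : Gr 𝒜 M) (n D : ℤ) : (G.shift n).hilb D = G.hilb (D + n) := by
  rw [hilb, shift_above, hilb]

lemma hilb_eq_zero (G : Gr 𝒜 M) {D : ℤ} (h : G.above D = ⊤) : G.hilb D = 0 := by
  have : Subsingleton (M ⧸ G.above D) := Submodule.Quotient.subsingleton_iff.2 h
  rw [hilb, Module.length_eq_zero]; rfl

lemma exists_hilb_eq_zero (G : Gr 𝒜 M) [Module.Finite A M] : ∃ a, ∀ D ≤ a, G.hilb D = 0 := by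
  obtain ⟨a, ha⟩ := G.exists_forall_above_eq_top
  exact ⟨a, fun D hD => G.hilb_eq_zero (ha D hD)⟩

open Classical in
/-- The generating series of `hilb`. -/
noncomputable def series (G : Gr 𝒜 M) : LaurentSeries ℤ :=
  if h : BddBelow (Function.support fun D => (G.hilb D : ℤ)) then
    HahnSeries.ofSuppBddBelow _ h else 0

lemma coeff_series (G : Gr 𝒜 M) [Module.Finite A M] (D : ℤ) :
    G.series.coeff D = G.hilb D := by
  rw [series, dif_pos, HahnSeries.ofSuppBddBelow_coeff]
  obtain ⟨a, ha⟩ := G.exists_hilb_eq_zero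
  refine ⟨a, fun D hD => ?_⟩
  by_contra h
  exact hD (by simp [ha D (by omega)])

lemma series_exact (hA : IsStandardGraded 𝒜) (G' : Gr 𝒜 M') (G : Gr 𝒜 M) (G'' : Gr 𝒜 M'')
    {f : M' →ₗ[A] M} {g : M →ₗ[A] M''} [Module.Finite A M'] [Module.Finite A M]
    [Module.Finite A M''] (hf : IsHom G' G f) (hg : IsHom G G'' g) (hinj : Function.Injective f)
    (hex : Function.Exact f g) (hsurj : Function.Surjective g) :
    G.series = G'.series + G''.series := by
  ext D
  rw [HahnSeries.coeff_add, coeff_series, coeff_series, coeff_series,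
    hilb_exact hA G' G G'' hf hg hinj hex hsurj D]
  push_cast; rfl

lemma series_congr (G : Gr 𝒜 M) (G' : Gr 𝒜 M') (e : M ≃ₗ[A] M') (he : IsHom G G' e) :
    G.series = G'.series := by
  have : G.hilb = G'.hilb := funext fun D => hilb_congr G G' e he D
  rw [series, series, this]

lemma series_eq_zero (G : Gr 𝒜 M) [Subsingleton M] : G.series = 0 := by
  have : Module.Finite A M := Module.Finite.of_finite
  ext D
  rw [coeff_series, G.hilb_eq_zero (Subsingleton.elim _ _)]; rfl

lemma series_shift (G : Gr 𝒜 M) [Module.Finite A M] (n : ℤ) :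
    (G.shift n).series = HahnSeries.single (-n) 1 * G.series := by
  ext D
  rw [coeff_series, hilb_shift, show D = (D + n) + -n by ring, HahnSeries.coeff_single_mul_add,
    coeff_series]
  simp

end Gr

/-! ### Poles at `1` of integral Laurent series. -/

section Pole

open Polynomial

/-- Polynomials as Laurent series. -/
noncomputable def polyToLaurent : ℤ[X] →+* LaurentSeries ℤ :=
  (HahnSeries.ofPowerSeries ℤ ℤ).comp Polynomial.coeToPowerSeries.ringHom

lemma polyToLaurent_injective : Function.Injective polyToLaurent :=
  HahnSeries.ofPowerSeries_injective.comp (Polynomial.coe_injective ℤ)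

lemma polyToLaurent_X : polyToLaurent X = HahnSeries.single 1 1 := by
  simp [polyToLaurent]

lemma polyToLaurent_X_pow (n : ℕ) : polyToLaurent (X ^ n) = HahnSeries.single (n : ℤ) 1 := by
  simp [polyToLaurent]

lemma coeff_polyToLaurent (Q : ℤ[X]) (n : ℕ) : (polyToLaurent Q).coeff n = Q.coeff n := by
  simp [polyToLaurent]

/-- `f` has a pole of order at most `d` at `1`, with leading coefficient `q`: up to a power of the
variable, `(1 - X) ^ d * f` is a polynomial with value `q` at `1`. -/
def HasPole (f : LaurentSeries ℤ) (d : ℕ) (q : ℤ) : Prop :=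
  ∃ (a : ℕ) (Q : ℤ[X]), polyToLaurent (X ^ a) * f * polyToLaurent ((1 - X) ^ d) = polyToLaurent Q ∧
    Q.eval 1 = q

namespace HasPole

variable {f g : LaurentSeries ℤ} {d e : ℕ} {q r : ℤ}

lemma zero (d : ℕ) : HasPole 0 d 0 := ⟨0, 0, by simp, by simp⟩

lemma add (hf : HasPole f d q) (hg : HasPole g d r) : HasPole (f + g) d (q + r) := by
  obtain ⟨a, Q, hQ, rfl⟩ := hf
  obtain ⟨b, R, hR, rfl⟩ := hg
  refine ⟨a + b, X ^ b * Q + X ^ a * R, ?_, by simp⟩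
  rw [map_add, map_mul, map_mul, ← hQ, ← hR, pow_add, map_mul]
  ring

lemma mul (hf : HasPole f d q) (hg : HasPole g e r) : HasPole (f * g) (d + e) (q * r) := by
  obtain ⟨a, Q, hQ, rfl⟩ := hf
  obtain ⟨b, R, hR, rfl⟩ := hg
  refine ⟨a + b, Q * R, ?_, by simp⟩
  rw [map_mul, ← hQ, ← hR, pow_add, pow_add, map_mul, map_mul]
  ring

lemma neg (hf : HasPole f d q) : HasPole (-f) d (-q) := by
  obtain ⟨a, Q, hQ, rfl⟩ := hf
  exact ⟨a, -Q, by rw [map_neg, ← hQ]; ring, by simp⟩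

lemma of_mul_one_sub (h : HasPole (f * polyToLaurent (1 - X)) d q) : HasPole f (d + 1) q := by
  obtain ⟨a, Q, hQ, rfl⟩ := h
  exact ⟨a, Q, by rw [← hQ, pow_succ', map_mul]; ring, rfl⟩

lemma mul_one_sub (h : HasPole f (d + 1) q) : HasPole (f * polyToLaurent (1 - X)) d q := by
  obtain ⟨a, Q, hQ, rfl⟩ := h
  exact ⟨a, Q, by rw [← hQ, pow_succ', map_mul]; ring, rfl⟩

lemma succ (h : HasPole f d q) : HasPole f (d + 1) 0 := by
  obtain ⟨a, Q, hQ, rfl⟩ := h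
  exact ⟨a, Q * (1 - X), by rw [map_mul, ← hQ, pow_succ, map_mul]; ring, by simp⟩

lemma of_lt (h : HasPole f d q) (hde : d < e) : HasPole f e 0 := by
  induction e, hde using Nat.le_induction with
  | base => exact h.succ
  | succ e _ ih => exact ih.succ

lemma single (n : ℤ) : HasPole (HahnSeries.single n 1) 0 1 := by
  rcases Int.eq_nat_or_neg n with ⟨k, rfl | rfl⟩
  · exact ⟨0, X ^ k, by rw [polyToLaurent_X_pow k]; simp, by simp⟩
  · exact ⟨k, 1, by rw [polyToLaurent_X_pow k]; simp, by simp⟩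

lemma single_mul (h : HasPole f d q) (n : ℤ) : HasPole (HahnSeries.single n 1 * f) d q := by
  simpa using (single n).mul h

lemma unique (h : HasPole f d q) (h' : HasPole f d r) : q = r := by
  obtain ⟨a, Q, hQ, rfl⟩ := h
  obtain ⟨b, R, hR, rfl⟩ := h'
  have : X ^ b * Q = X ^ a * R := by
    apply polyToLaurent_injective
    rw [map_mul, map_mul, ← hQ, ← hR]; ring
  simpa using congrArg (Polynomial.eval 1) this

end HasPole

lemma coeff_mul_one_sub_X (f : LaurentSeries ℤ) (n : ℤ) :
    (f * polyToLaurent (1 - X)).coeff n = f.coeff n - f.coeff (n - 1) := by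
  rw [map_sub, map_one, polyToLaurent_X, mul_sub, mul_one, HahnSeries.coeff_sub, mul_comm f]
  congr 1
  conv_lhs => rw [show n = n - 1 + 1 by ring]
  rw [HahnSeries.coeff_single_mul_add, one_mul]

lemma HasPole.exists_coeff_eq_zero {f : LaurentSeries ℤ} {q : ℤ} (h : HasPole f 0 q) :
    ∃ E : ℕ, ∀ n : ℕ, E < n → f.coeff n = 0 := by
  obtain ⟨a, Q, hQ, -⟩ := h
  refine ⟨Q.natDegree, fun n hn => ?_⟩
  have := coeff_polyToLaurent Q (n + a)
  rw [← hQ, polyToLaurent_X_pow a, Polynomial.coeff_eq_zero_of_natDegree_lt (by omega)] at this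
  simpa [HahnSeries.coeff_single_mul_add] using this

/-- The coefficients of a series with a pole of order `d + 1` grow at most like `n ^ d`. -/
lemma HasPole.exists_coeff_le {d : ℕ} {f : LaurentSeries ℤ} {q : ℤ} (h : HasPole f (d + 1) q) :
    ∃ K : ℕ, ∀ n : ℕ, f.coeff n ≤ K * (n + 1) ^ d := by
  induction d generalizing f q with
  | zero =>
    obtain ⟨E, hE⟩ := h.mul_one_sub.exists_coeff_eq_zero
    -- For a simple pole the differences of consecutive coefficients vanish beyond `E`, so the
    -- coefficients with index in `[0, E]` bound all of them.
    refine ⟨∑ j ∈ Finset.range (E + 1), (f.coeff j).natAbs, fun n => ?_⟩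
    simp only [pow_zero, mul_one]
    induction n with
    | zero =>
      refine Int.le_natAbs.trans ?_
      exact_mod_cast Finset.single_le_sum (f := fun j : ℕ => (f.coeff j).natAbs)
        (fun _ _ => Nat.zero_le _) (by simp : 0 ∈ Finset.range (E + 1))
    | succ n ih =>
      rcases le_or_gt (n + 1) E with h | h
      · refine Int.le_natAbs.trans ?_
        exact_mod_cast Finset.single_le_sum (f := fun j : ℕ => (f.coeff j).natAbs)
          (fun _ _ => Nat.zero_le _) (by simp; omega : n + 1 ∈ Finset.range (E + 1))
      · have := hE (n + 1) h
        rw [coeff_mul_one_sub_X] at this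
        push_cast at this ih ⊢
        rw [add_sub_cancel_right] at this
        linarith
  | succ d ih =>
    obtain ⟨K, hK⟩ := ih h.mul_one_sub
    -- Multiplying by `1 - X` takes differences, which are at most `K (n + 1) ^ d` by induction.
    -- Summing gains one power of `n`, and the initial value is absorbed in the constant.
    refine ⟨K + (f.coeff 0).natAbs, fun n => ?_⟩
    have h0 : (0 : ℤ) ≤ ((K + (f.coeff 0).natAbs : ℕ) : ℤ) := Int.natCast_nonneg _
    induction n with
    | zero =>
      simp only [Nat.cast_zero, zero_add, one_pow, mul_one]
      exact Int.le_natAbs.trans (by push_cast; linarith [Int.natCast_nonneg K])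
    | succ n ihn =>
      have h1 := hK (n + 1)
      rw [coeff_mul_one_sub_X] at h1
      push_cast at h1 ihn h0 ⊢
      rw [add_sub_cancel_right] at h1
      have h2 : ((n : ℤ) + 1) ^ (d + 1) ≤ (n + 1) * (n + 1 + 1) ^ d := by
        rw [pow_succ']
        gcongr
        linarith
      have h3 : (0 : ℤ) ≤ (n + 1 + 1) ^ d := by positivity
      calc f.coeff ((n : ℤ) + 1) ≤ K * (n + 1 + 1) ^ d + f.coeff n := by linarith
        _ ≤ (K + |f.coeff 0|) * (n + 1 + 1) ^ d
            + (K + |f.coeff 0|) * ((n + 1) * (n + 1 + 1) ^ d) := by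
          refine add_le_add ?_ (ihn.trans ?_)
          · exact mul_le_mul_of_nonneg_right (by linarith [abs_nonneg (f.coeff 0)]) h3
          · exact mul_le_mul_of_nonneg_left h2 h0
        _ = _ := by ring

end Pole

/-! ### Dimension of the support through coheights of primes. -/

section SupportDim

variable {A : Type*} [CommRing A]

lemma WithBot.eq_natCast_iff {x : WithBot ℕ∞} {d : ℕ} :
    x = d ↔ (d : WithBot ℕ∞) ≤ x ∧ ¬ ((d + 1 : ℕ) : WithBot ℕ∞) ≤ x := by
  induction x using WithBot.recBotCoe with
  | bot =>
    exact ⟨fun h => absurd h (WithBot.bot_ne_coe (a := (d : ℕ∞))),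
      fun h => absurd h.1 (WithBot.not_coe_le_bot (d : ℕ∞))⟩
  | coe x =>
    rw [show (d : WithBot ℕ∞) = ((d : ℕ∞) : WithBot ℕ∞) from rfl,
      show ((d + 1 : ℕ) : WithBot ℕ∞) = ((d + 1 : ℕ) : ℕ∞) from rfl, WithBot.coe_inj,
      WithBot.coe_le_coe, WithBot.coe_le_coe]
    induction x using ENat.recTopCoe with
    | top => simp
    | coe x => norm_cast; omega

/-- The support is closed under passing to larger primes, so a chain lies in it as soon as its
smallest member does. -/
lemma Module.le_supportDim_iff {M : Type*} [AddCommGroup M] [Module A M] {n : ℕ} :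
    (n : WithBot ℕ∞) ≤ Module.supportDim A M ↔
      ∃ p ∈ Module.support A M, (n : ℕ∞) ≤ Order.coheight p := by
  rw [Module.supportDim, Order.le_krullDim_iff]
  constructor
  · rintro ⟨l, rfl⟩
    exact ⟨l.head.1, l.head.2,
      Order.length_le_coheight (p := l.map Subtype.val (fun _ _ h => h)) le_rfl⟩
  · rintro ⟨p, hp, h⟩
    obtain ⟨l, rfl, rfl⟩ := Order.exists_series_of_le_coheight p h
    exact ⟨⟨l.length, fun i => ⟨l i, Module.mem_support_mono (l.head_le i) hp⟩,
      fun i => l.step i⟩, rfl⟩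

lemma Module.le_supportDim_iff_of_exact {M' M M'' : Type*} [AddCommGroup M] [Module A M]
    [AddCommGroup M'] [Module A M'] [AddCommGroup M''] [Module A M''] {f : M' →ₗ[A] M}
    {g : M →ₗ[A] M''} (hinj : Function.Injective f) (hex : Function.Exact f g)
    (hsurj : Function.Surjective g) {n : ℕ} :
    (n : WithBot ℕ∞) ≤ Module.supportDim A M ↔
      (n : WithBot ℕ∞) ≤ Module.supportDim A M' ∨ (n : WithBot ℕ∞) ≤ Module.supportDim A M'' := by
  simp only [Module.le_supportDim_iff, Module.support_of_exact hex hinj hsurj, Set.mem_union]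
  constructor
  · rintro ⟨p, hp | hp, h⟩
    exacts [Or.inl ⟨p, hp, h⟩, Or.inr ⟨p, hp, h⟩]
  · rintro (⟨p, hp, h⟩ | ⟨p, hp, h⟩)
    exacts [⟨p, Or.inl hp, h⟩, ⟨p, Or.inr hp, h⟩]

lemma Module.le_supportDim_quotient_iff (p : Ideal A) [hp : p.IsPrime] {n : ℕ} :
    (n : WithBot ℕ∞) ≤ Module.supportDim A (A ⧸ p) ↔
      (n : ℕ∞) ≤ Order.coheight (⟨p, hp⟩ : PrimeSpectrum A) := by
  rw [Module.le_supportDim_iff, Module.support_eq_zeroLocus, Ideal.annihilator_quotient]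
  constructor
  · rintro ⟨q, hq, h⟩
    exact h.trans (Order.coheight_anti (show (⟨p, hp⟩ : PrimeSpectrum A) ≤ q from hq))
  · exact fun h => ⟨_, fun _ h => h, h⟩

end SupportDim

/-! ### Chains of arbitrary primes force growth. -/

section Growth

variable {A : Type u} [CommRing A] (𝒜 : ℕ → AddSubgroup A) [GradedRing 𝒜]

/-- The elements of the ring all of whose components have degree at most `D`. -/
def below (D : ℕ) : Submodule (SetLike.GradeZero.subring 𝒜) A where
  carrier := {a | ∀ j : ℤ, D < j → (Gr.self 𝒜).comp j a = 0}
  add_mem' ha hb j hj := by rw [map_add, ha j hj, hb j hj, add_zero]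
  zero_mem' j _ := map_zero _
  smul_mem' r a ha j hj := by
    change (Gr.self 𝒜).comp j ((r : A) • a) = 0
    rw [Gr.comp_smul' _ r.2, ha _ (by simpa using hj), smul_zero]

variable {𝒜}

lemma mul_mem_below {D e : ℕ} {f a : A} (hf : f ∈ below 𝒜 e) (ha : a ∈ below 𝒜 D) :
    f * a ∈ below 𝒜 (D + e) := by
  obtain ⟨s, hs⟩ := (Gr.self 𝒜).exists_sum f
  rw [← hs, Finset.sum_mul]
  refine Submodule.sum_mem _ fun i _ j hj => ?_
  rcases lt_or_ge i 0 with h0 | h0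
  · rw [Gr.self_comp_of_neg 𝒜 h0, zero_mul, map_zero]
  rcases lt_or_ge (e : ℤ) i with h1 | h1
  · rw [hf i h1, zero_mul, map_zero]
  lift i to ℕ using h0
  rw [Gr.self_comp_natCast, ← smul_eq_mul, Gr.comp_smul' _ (SetLike.coe_mem _),
    ha _ (by push_cast at hj; omega), smul_zero]

lemma one_mem_below (D : ℕ) : (1 : A) ∈ below 𝒜 D := fun j hj => by
  lift j to ℕ using by omega
  rw [Gr.self_comp_natCast, DirectSum.decompose_of_mem_ne 𝒜 SetLike.GradedOne.one_mem (by omega)]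

lemma below_mono : Monotone (below 𝒜) := fun _ _ h _ ha j hj => ha j (by omega)

lemma exists_mem_below (a : A) : ∃ e, a ∈ below 𝒜 e := by
  obtain ⟨E, hE⟩ := (Gr.self 𝒜).exists_comp_eq_zero a
  exact ⟨E.toNat, fun j hj => hE j (by omega)⟩

variable (𝒜)

/-- The length over the degree zero subring of the image in `A ⧸ I` of the elements of degree at
most `D`; the ideal need not be homogeneous. -/
noncomputable def growth (I : Ideal A) (D : ℕ) : ℕ∞ :=
  Module.length (SetLike.GradeZero.subring 𝒜) (below 𝒜 D ⧸ (I.restrictScalars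
    (SetLike.GradeZero.subring 𝒜)).comap (below 𝒜 D).subtype)

variable {𝒜}

lemma one_le_growth {I : Ideal A} (hI : I ≠ ⊤) (D : ℕ) : 1 ≤ growth 𝒜 I D := by
  rw [growth, Order.one_le_iff_pos, Module.length_pos_iff, Submodule.Quotient.nontrivial_iff]
  intro h
  have : (⟨1, one_mem_below D⟩ : below 𝒜 D) ∈
    (I.restrictScalars (SetLike.GradeZero.subring 𝒜)).comap (below 𝒜 D).subtype := by
      rw [h]; trivial
  exact hI ((Ideal.eq_top_iff_one I).2 this)

lemma Module.length_add_le_of_comp_eq_zero {R X Y Z : Type*} [Ring R] [AddCommGroup X] [Module R X]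
    [AddCommGroup Y] [Module R Y] [AddCommGroup Z] [Module R Z] (f : X →ₗ[R] Y) (g : Y →ₗ[R] Z)
    (hf : Function.Injective f) (hg : Function.Surjective g) (h : g ∘ₗ f = 0) :
    Module.length R X + Module.length R Z ≤ Module.length R Y := by
  rw [Module.length_eq_add_of_exact (LinearMap.ker g).subtype g (Submodule.subtype_injective _) hg
    (LinearMap.exact_subtype_ker_map g)]
  gcongr
  refine Module.length_le_of_injective
    (f.codRestrict (LinearMap.ker g) fun x => LinearMap.congr_fun h x) ?_
  exact fun x y hxy => hf (congrArg Subtype.val hxy)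

/-- Multiplication by `f` is injective on the domain `A ⧸ p` and raises degrees by at most `e`; its
image dies in `A ⧸ q`. The two lengths therefore fit side by side in degrees at most `D + e`. -/
lemma growth_add_le {p q : Ideal A} [hp : p.IsPrime] (hpq : p ≤ q) {f : A} (hfq : f ∈ q)
    (hfp : f ∉ p) {e : ℕ} (hf : f ∈ below 𝒜 e) (D : ℕ) :
    growth 𝒜 p D + growth 𝒜 q (D + e) ≤ growth 𝒜 p (D + e) := by
  let m : below 𝒜 D →ₗ[SetLike.GradeZero.subring 𝒜] below 𝒜 (D + e) :=
    { toFun a := ⟨f * a, mul_mem_below hf a.2⟩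
      map_add' a b := by ext; simp [mul_add]
      map_smul' r a := by ext; simp }
  set R₀ := SetLike.GradeZero.subring 𝒜
  have h1 : (p.restrictScalars R₀).comap (below 𝒜 D).subtype ≤
      ((p.restrictScalars R₀).comap (below 𝒜 (D + e)).subtype).comap m :=
    fun a ha => p.mul_mem_left f (show (a : A) ∈ p from ha)
  have h2 : (p.restrictScalars R₀).comap (below 𝒜 (D + e)).subtype ≤
      ((q.restrictScalars R₀).comap (below 𝒜 (D + e)).subtype).comap LinearMap.id :=
    fun a ha => hpq (show (a : A) ∈ p from ha)
  refine Module.length_add_le_of_comp_eq_zero (Submodule.mapQ _ _ m h1)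
    (Submodule.mapQ _ _ LinearMap.id h2) ?_ ?_ ?_
  · rw [← LinearMap.ker_eq_bot, LinearMap.ker_eq_bot']
    intro x hx
    obtain ⟨a, rfl⟩ := Submodule.Quotient.mk_surjective _ x
    rw [Submodule.mapQ_apply, Submodule.Quotient.mk_eq_zero] at hx
    rw [Submodule.Quotient.mk_eq_zero]
    exact (hp.mem_or_mem (show f * (a : A) ∈ p from hx)).resolve_left hfp
  · intro y
    obtain ⟨a, rfl⟩ := Submodule.Quotient.mk_surjective _ y
    exact ⟨Submodule.Quotient.mk a, rfl⟩
  · refine LinearMap.ext fun x => ?_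
    obtain ⟨a, rfl⟩ := Submodule.Quotient.mk_surjective _ x
    rw [LinearMap.comp_apply, Submodule.mapQ_apply, Submodule.mapQ_apply, LinearMap.zero_apply,
      Submodule.Quotient.mk_eq_zero]
    exact q.mul_mem_right _ hfq

/-- Long chains of primes force fast growth. -/
lemma exists_choose_le_growth (k : ℕ) (p : PrimeSpectrum A) (h : (k : ℕ∞) ≤ Order.coheight p) :
    ∃ e₀, ∀ e ≥ e₀, ∀ m : ℕ, ((m + k).choose k : ℕ∞) ≤ growth 𝒜 p.asIdeal (m * e) := by
  induction k generalizing p with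
  | zero => exact ⟨0, fun e _ m => by simpa using one_le_growth p.2.ne_top _⟩
  | succ k ih =>
    obtain ⟨q, hpq, hq⟩ : ∃ q > p, (k : ℕ∞) ≤ Order.coheight q := by
      by_contra! hcon
      have := (Order.coheight_le_coe_iff (x := p) (n := k)).2 hcon
      have := h.trans this
      norm_cast at this
      omega
    obtain ⟨e₁, he₁⟩ := ih q hq
    obtain ⟨f, hfq, hfp⟩ := SetLike.exists_of_lt (show p.asIdeal < q.asIdeal from hpq)
    obtain ⟨e₂, he₂⟩ := exists_mem_below (𝒜 := 𝒜) f
    -- The step `e` must be large enough for the induction hypothesis at `q` and for the degree of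
    -- `f`. Induction on `m` through `growth_add_le` then reproduces Pascal's rule.
    refine ⟨max e₁ e₂, fun e he m => ?_⟩
    induction m with
    | zero => simpa using one_le_growth p.2.ne_top _
    | succ m ihm =>
      have h1 := growth_add_le hpq.le hfq hfp (below_mono (le_of_max_le_right he) he₂) (m * e)
      rw [show m * e + e = (m + 1) * e by ring] at h1
      refine le_trans ?_ h1
      have h2 := he₁ e (le_of_max_le_left he) (m + 1)
      rw [show m + 1 + (k + 1) = (m + k + 1) + 1 by ring, Nat.choose_succ_succ', Nat.cast_add,
        add_comm]
      rw [show m + 1 + k = m + k + 1 by ring] at h2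
      exact add_le_add ihm h2

end Growth

/-! ### Growth is bounded by the Hilbert function. -/

section LengthZero

variable {A : Type u} [CommRing A] {𝒜 : ℕ → AddSubgroup A} [GradedRing 𝒜]

/-- When `A_1` acts as zero, `A` acts through its degree zero part, so each `A_0`-submodule is
already an `A`-submodule. -/
lemma length_le_of_annihilated (hA : IsStandardGraded 𝒜) {X : Type*} [AddCommGroup X] [Module A X]
    [Module (SetLike.GradeZero.subring 𝒜) X] [IsScalarTower (SetLike.GradeZero.subring 𝒜) A X]
      (h : ∀ a ∈ 𝒜 1, ∀ x : X, a • x = 0) :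
    Module.length (SetLike.GradeZero.subring 𝒜) X ≤ Module.length A X := by
  have key (N : Submodule (SetLike.GradeZero.subring 𝒜) X) (a : A) (x : X) (hx : x ∈ N)
    : a • x ∈ N := by
    obtain ⟨b, hb⟩ := hA.exists_sub_mem (Module.annihilator A X)
      (fun a ha => Module.mem_annihilator.2 (h a ha)) a
    have := Module.mem_annihilator.1 hb x
    rw [sub_smul, sub_eq_zero] at this
    rw [this]
    have h2 := N.smul_mem (⟨b, b.2⟩ : SetLike.GradeZero.subring 𝒜) hx
    rwa [← algebraMap_smul A (⟨b, b.2⟩ : SetLike.GradeZero.subring 𝒜) x] at h2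
  rw [← WithBot.coe_le_coe, Module.coe_length, Module.coe_length]
  exact Order.krullDim_le_of_strictMono
    (fun N => { N with smul_mem' := fun a x hx => key N a x hx }) fun _ _ h => h

/-- Filter by powers of the irrelevant ideal; each layer is killed by `A_1`, and both lengths are
additive. -/
lemma length_le_of_pow_annihilated (hA : IsStandardGraded 𝒜) (n : ℕ) {X : Type*} [AddCommGroup X]
    [Module A X] [Module (SetLike.GradeZero.subring 𝒜) X]
      [IsScalarTower (SetLike.GradeZero.subring 𝒜) A X]
    (h : (Ideal.span (𝒜 1 : Set A)) ^ n ≤ Module.annihilator A X) :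
    Module.length (SetLike.GradeZero.subring 𝒜) X ≤ Module.length A X := by
  induction n generalizing X with
  | zero =>
    have : Subsingleton X := by
      rw [← Module.annihilator_eq_top_iff (R := A), ← top_le_iff]
      simpa using h
    simp [Module.length_eq_zero]
  | succ n ih =>
    set Y : Submodule A X := Ideal.span (𝒜 1 : Set A) • ⊤ with hY
    have e1 := Module.length_eq_add_of_exact Y.subtype Y.mkQ Y.subtype_injective
      Y.mkQ_surjective (LinearMap.exact_subtype_mkQ Y)
    have e2 := Module.length_eq_add_of_exact (Y.subtype.restrictScalars
      (SetLike.GradeZero.subring 𝒜))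
      (Y.mkQ.restrictScalars (SetLike.GradeZero.subring 𝒜)) Y.subtype_injective
      Y.mkQ_surjective (LinearMap.exact_subtype_mkQ Y)
    rw [e1, e2]
    refine add_le_add (ih fun a ha => ?_) (length_le_of_annihilated hA fun a ha x => ?_)
    · rw [Module.mem_annihilator]
      rintro ⟨y, hy⟩
      ext
      change a • y = 0
      induction hy using Submodule.smul_induction_on' with
      | smul r hr x _ =>
        rw [smul_smul]
        exact Module.mem_annihilator.1 (h (by rw [pow_succ]; exact Ideal.mul_mem_mul ha hr)) x
      | add x _ y _ hx hy => rw [smul_add, hx, hy, add_zero]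
    · obtain ⟨x, rfl⟩ := Submodule.Quotient.mk_surjective _ x
      rw [← Submodule.Quotient.mk_smul, Submodule.Quotient.mk_eq_zero]
      exact Submodule.smul_mem_smul (Ideal.subset_span ha) trivial

namespace Gr

variable {M : Type*} [AddCommGroup M] [Module A M]

lemma pow_smul_top_le_above (G : Gr 𝒜 M) {a : ℤ} (ha : G.above a = ⊤) (n : ℕ) :
    (Ideal.span (𝒜 1 : Set A)) ^ n • (⊤ : Submodule A M) ≤ G.above (a + n) := by
  induction n with
  | zero => simp [ha]
  | succ n ih =>
    rw [pow_succ', mul_smul]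
    refine (Submodule.smul_mono le_rfl ih).trans ?_
    rw [Submodule.span_smul_eq, Submodule.set_smul_le_iff (R := A)]
    intro r m hr hm j hj
    rw [G.comp_smul' hr, hm _ (by push_cast at *; omega), smul_zero]

lemma length_zero_quotient_above_le (hA : IsStandardGraded 𝒜) (G : Gr 𝒜 M) [Module.Finite A M]
    [Module (SetLike.GradeZero.subring 𝒜) M] [IsScalarTower (SetLike.GradeZero.subring 𝒜) A M]
      (D : ℤ) :
    Module.length (SetLike.GradeZero.subring 𝒜) (M ⧸ G.above D) ≤ Module.length A (M ⧸ G.above D)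
      := by
  obtain ⟨a, ha⟩ := G.exists_above_eq_top
  refine length_le_of_pow_annihilated hA (D - a).toNat fun r hr => ?_
  rw [Module.mem_annihilator]
  intro x
  obtain ⟨x, rfl⟩ := Submodule.Quotient.mk_surjective _ x
  rw [← Submodule.Quotient.mk_smul, Submodule.Quotient.mk_eq_zero]
  exact G.above_antitone (by omega)
    (G.pow_smul_top_le_above ha _ (Submodule.smul_mem_smul hr trivial))

/-- The elements of degree at most `D` map to the truncation of `A ⧸ p`. Homogeneity of `p` makes
the kernel exactly their part in `p`: such an element vanishing in the truncation has all its
components in `p`. -/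
lemma growth_le_hilb (hA : IsStandardGraded 𝒜) (p : Ideal A) (hp : (self 𝒜).IsHomogeneous p)
    (D : ℕ) : growth 𝒜 p D ≤ ((self 𝒜).quot p hp).hilb D := by
  rw [natCast_hilb hA]
  refine le_trans ?_ (length_zero_quotient_above_le hA _ _)
  refine Module.length_le_of_injective (Submodule.liftQ _
    (((((self 𝒜).quot p hp).above D).mkQ.restrictScalars (SetLike.GradeZero.subring 𝒜)).comp
      ((p.mkQ.restrictScalars (SetLike.GradeZero.subring 𝒜)).comp (below 𝒜 D).subtype))
        fun a ha => ?_) ?_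
  · rw [LinearMap.mem_ker]
    have : p.mkQ (a : A) = 0 := (Submodule.Quotient.mk_eq_zero p).2 ha
    simp only [LinearMap.comp_apply, LinearMap.restrictScalars_apply, Submodule.subtype_apply, this,
      map_zero]
  · rw [← LinearMap.ker_eq_bot, LinearMap.ker_eq_bot']
    intro x hx
    obtain ⟨a, rfl⟩ := Submodule.Quotient.mk_surjective _ x
    rw [Submodule.liftQ_apply] at hx
    rw [Submodule.Quotient.mk_eq_zero]
    have h1 : p.mkQ (a : A) ∈ ((self 𝒜).quot p hp).above D :=
      (Submodule.Quotient.mk_eq_zero _).1 hx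
    change (a : A) ∈ p
    rw [← Submodule.Quotient.mk_eq_zero p]
    refine ((self 𝒜).quot p hp).eq_zero fun j => ?_
    rcases le_or_gt j D with hj | hj
    · exact h1 j hj
    · change p.mkQ ((self 𝒜).comp j a) = 0
      rw [a.2 j hj, map_zero]

end Gr

lemma Nat.not_forall_choose_le (d K e : ℕ) :
    ¬ ∀ m : ℕ, (m + (d + 1)).choose (d + 1) ≤ K * (m * e + 1) ^ d := by
  intro h
  -- This value makes the two bounds collapse to `(m + 1) ^ (d + 1) ≤ m * (m + 1) ^ d`, which is
  -- absurd.
  set m := (d + 1).factorial * K * (e + 1) ^ d with hm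
  have h1 : (m + 1) ^ (d + 1) ≤ (d + 1).factorial * (m + (d + 1)).choose (d + 1) := by
    rw [← Nat.ascFactorial_eq_factorial_mul_choose]
    exact Nat.pow_succ_le_ascFactorial _ _
  have h2 : (m * e + 1) ^ d ≤ (e + 1) ^ d * (m + 1) ^ d := by
    rw [← mul_pow]
    gcongr
    nlinarith
  have h3 : (m + 1) ^ (d + 1) ≤ m * (m + 1) ^ d :=
    calc (m + 1) ^ (d + 1) ≤ (d + 1).factorial * (K * (m * e + 1) ^ d) :=
          h1.trans (Nat.mul_le_mul_left _ (h m))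
      _ ≤ (d + 1).factorial * (K * ((e + 1) ^ d * (m + 1) ^ d)) := by gcongr
      _ = m * (m + 1) ^ d := by rw [hm]; ring
  rw [pow_succ'] at h3
  have := Nat.le_of_mul_le_mul_right h3 (by positivity)
  omega

/-- A pole of order `d + 1` allows growth of degree at most `d`, whereas a chain of `d + 1` strict
inclusions above `p`, through homogeneous primes or not, would force degree `d + 1`. -/
lemma not_succ_le_coheight_of_hasPole (hA : IsStandardGraded 𝒜) (p : PrimeSpectrum A)
    (hp : (Gr.self 𝒜).IsHomogeneous p.asIdeal) {d : ℕ} {q : ℤ}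
    (h : HasPole ((Gr.self 𝒜).quot p.asIdeal hp).series (d + 1) q) :
    ¬ ((d + 1 : ℕ) : ℕ∞) ≤ Order.coheight p := by
  intro hd
  obtain ⟨K, hK⟩ := h.exists_coeff_le
  obtain ⟨e, he⟩ := exists_choose_le_growth (𝒜 := 𝒜) (d + 1) p hd
  refine Nat.not_forall_choose_le d K e fun m => ?_
  have h1 := (he e le_rfl m).trans (Gr.growth_le_hilb hA p.asIdeal hp (m * e))
  have h2 := hK (m * e)
  rw [Gr.coeff_series] at h2
  norm_cast at h1 h2
  exact h1.trans (by exact_mod_cast h2)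

end LengthZero

/-! ### The order of the pole is the dimension plus one. -/

namespace Gr

variable {A : Type u} [CommRing A] {𝒜 : ℕ → AddSubgroup A} [GradedRing 𝒜]
variable {M : Type u} [AddCommGroup M] [Module A M] {M' : Type u} [AddCommGroup M'] [Module A M']
  {M'' : Type u} [AddCommGroup M''] [Module A M'']

/-- The pole at `1` of the cumulative Hilbert series is governed by the Krull dimension. -/
def PoleEqDim (G : Gr 𝒜 M) : Prop :=
  Nontrivial M → ∃ d : ℕ, Module.supportDim A M = d ∧ ∃ q > 0, HasPole G.series (d + 1) q

lemma PoleEqDim.shift {G : Gr 𝒜 M} [Module.Finite A M] (h : G.PoleEqDim) (n : ℤ) :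
    (G.shift n).PoleEqDim := fun hM => by
  obtain ⟨d, hd, q, hq, hp⟩ := h hM
  exact ⟨d, hd, q, hq, by rw [series_shift]; exact hp.single_mul _⟩

lemma supportDim_eq_natCast_of_exact {f : M' →ₗ[A] M} {g : M →ₗ[A] M''}
    (hinj : Function.Injective f) (hex : Function.Exact f g) (hsurj : Function.Surjective g)
    {d' d'' : ℕ} (h' : Module.supportDim A M' = d') (h'' : Module.supportDim A M'' = d'') :
    Module.supportDim A M = (max d' d'' : ℕ) := by
  rw [WithBot.eq_natCast_iff, Module.le_supportDim_iff_of_exact hinj hex hsurj,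
    Module.le_supportDim_iff_of_exact hinj hex hsurj, h', h'']
  constructor
  · rcases max_cases d' d'' with ⟨h, _⟩ | ⟨h, _⟩ <;> rw [h] <;> simp
  · rintro (h | h) <;> norm_cast at h <;> omega

/-- The outer term of larger dimension dominates the pole. In equal dimensions the leading
coefficients add, and positivity excludes cancellation. -/
lemma PoleEqDim.of_exact (hA : IsStandardGraded 𝒜) {G' : Gr 𝒜 M'} {G : Gr 𝒜 M} {G'' : Gr 𝒜 M''}
    {f : M' →ₗ[A] M} {g : M →ₗ[A] M''} [Module.Finite A M'] [Module.Finite A M]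
    [Module.Finite A M''] (hf : IsHom G' G f) (hg : IsHom G G'' g) (hinj : Function.Injective f)
    (hex : Function.Exact f g) (hsurj : Function.Surjective g) (h' : G'.PoleEqDim)
    (h'' : G''.PoleEqDim) : G.PoleEqDim := by
  intro hM
  rw [series_exact hA G' G G'' hf hg hinj hex hsurj]
  rcases subsingleton_or_nontrivial M' with hs' | hs'
  · have : Function.Injective g := by
      rw [injective_iff_map_eq_zero]
      intro m hm
      obtain ⟨x, rfl⟩ := (hex m).1 hm
      rw [Subsingleton.elim x 0, map_zero]
    obtain ⟨d, hd, h⟩ := h'' this.nontrivial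
    rw [series_eq_zero, zero_add]
    exact ⟨d, by rw [Module.supportDim_eq_of_equiv (LinearEquiv.ofBijective g ⟨this, hsurj⟩),
      hd], h⟩
  rcases subsingleton_or_nontrivial M'' with hs'' | hs''
  · have : Function.Surjective f := fun m => (hex m).1 (Subsingleton.elim _ _)
    obtain ⟨d, hd, h⟩ := h' hs'
    rw [series_eq_zero G'', add_zero]
    exact ⟨d, by rw [← Module.supportDim_eq_of_equiv (LinearEquiv.ofBijective f ⟨hinj, this⟩), hd],
      h⟩
  obtain ⟨d', hd', q', hq', hp'⟩ := h' hs'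
  obtain ⟨d'', hd'', q'', hq'', hp''⟩ := h'' hs''
  refine ⟨_, supportDim_eq_natCast_of_exact hinj hex hsurj hd' hd'', ?_⟩
  rcases lt_trichotomy d' d'' with h | rfl | h
  · rw [max_eq_right h.le]
    exact ⟨0 + q'', by linarith, (hp'.of_lt (by omega)).add hp''⟩
  · rw [max_self]
    exact ⟨q' + q'', by linarith, hp'.add hp''⟩
  · rw [max_eq_left h.le]
    exact ⟨q' + 0, by linarith, hp'.add (hp''.of_lt (by omega))⟩

omit [GradedRing 𝒜] in
lemma exists_homogeneous_ne_zero (G : Gr 𝒜 M) [Nontrivial M] :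
    ∃ j m, G.comp j m = m ∧ m ≠ 0 := by
  obtain ⟨m, hm⟩ := exists_ne (0 : M)
  by_contra! h
  exact hm (G.eq_zero fun j => h j _ (G.comp_self j m))

lemma isHom_toSpanSingleton (G : Gr 𝒜 M) {j : ℤ} {m : M} (hm : G.comp j m = m) :
    IsHom ((self 𝒜).shift (-j)) G (LinearMap.toSpanSingleton A M m) := by
  intro i a
  induction a using DirectSum.Decomposition.inductionOn 𝒜 with
  | zero => simp
  | @homogeneous k a =>
    rw [LinearMap.toSpanSingleton_apply, G.comp_smul' a.2, LinearMap.toSpanSingleton_apply,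
      shift_comp]
    conv_rhs => rw [← mul_one (a : A), ← smul_eq_mul, (self 𝒜).comp_smul' a.2]
    have h1 : (self 𝒜).comp (i + -j - k) 1 = if i - k = j then 1 else 0 := by
      rcases lt_or_ge (i + -j - k) 0 with h0 | h0
      · rw [self_comp_of_neg 𝒜 h0, if_neg (by omega)]
      · obtain ⟨n, hn⟩ := Int.eq_ofNat_of_zero_le h0
        rw [hn, self_comp_natCast]
        by_cases hn0 : n = 0
        · subst hn0
          rw [DirectSum.decompose_of_mem_same 𝒜 SetLike.GradedOne.one_mem, if_pos (by omega)]
        · rw [DirectSum.decompose_of_mem_ne 𝒜 SetLike.GradedOne.one_mem (Ne.symm hn0),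
            if_neg (by omega)]
    rw [h1, ← hm, G.comp_comp, hm]
    split_ifs <;> simp
  | add a b ha hb => simp only [map_add, ha, hb]

lemma isHomogeneous_iff (I : Ideal A) : (self 𝒜).IsHomogeneous I ↔ I.IsHomogeneous 𝒜 := by
  constructor
  · intro h i a ha
    rw [← self_comp_natCast]; exact h i a ha
  · intro h j a ha
    rcases lt_or_ge j 0 with hj | hj
    · rw [self_comp_of_neg 𝒜 hj]; exact I.zero_mem
    · lift j to ℕ using hj
      rw [self_comp_natCast]; exact h j ha

/-- Graded modules over Noetherian rings have homogeneous associated primes. -/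
lemma exists_isPrime_ker_toSpanSingleton [IsNoetherianRing A] (G : Gr 𝒜 M) [Nontrivial M] :
    ∃ j m, G.comp j m = m ∧ Ideal.IsPrime (LinearMap.ker (LinearMap.toSpanSingleton A M m)) := by
  obtain ⟨j₀, m₀, h₀, hm₀⟩ := G.exists_homogeneous_ne_zero
  obtain ⟨I, ⟨j, m, hm, hm0, rfl⟩, hmax⟩ := set_has_maximal_iff_noetherian.2
    (inferInstanceAs (IsNoetherian A A))
    {I : Ideal A | ∃ j m, G.comp j m = m ∧ m ≠ 0 ∧ LinearMap.ker (LinearMap.toSpanSingleton A M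
      m) = I}
    ⟨_, j₀, m₀, h₀, hm₀, rfl⟩
  refine ⟨j, m, hm, ?_⟩
  have hI : Ideal.IsHomogeneous 𝒜 (LinearMap.ker (LinearMap.toSpanSingleton A M m)) := by
    rw [← isHomogeneous_iff]
    intro i a ha
    have := (G.isHom_toSpanSingleton hm).isHomogeneous_ker (i + j) a ha
    simpa using this
  -- Primality of a homogeneous ideal may be tested on homogeneous elements. For homogeneous `y`
  -- with `y • m ≠ 0`, the annihilator of `y • m` competes with that of `m`, and maximality applies.
  refine hI.isPrime_of_homogeneous_mem_or_mem ?_ ?_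
  · rw [Ne, Ideal.eq_top_iff_one]
    simpa using hm0
  · rintro x y - ⟨k, hy⟩ hxy
    by_contra! hcon
    obtain ⟨hx, hy'⟩ := hcon
    have hym : y • m ≠ 0 := hy'
    refine hmax _ ⟨k + j, y • m, by rw [G.comp_smul k j y m hy, hm], hym, rfl⟩
      (SetLike.lt_iff_le_and_exists.2 ⟨fun a ha => ?_, x, ?_, hx⟩)
    · rw [LinearMap.mem_ker, LinearMap.toSpanSingleton_apply] at *
      rw [smul_comm, ha, smul_zero]
    · rw [LinearMap.mem_ker, LinearMap.toSpanSingleton_apply] at *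
      rwa [smul_smul]

/-- Dévissage: it is enough to treat quotients by homogeneous primes. -/
lemma poleEqDim_of_primes (hA : IsStandardGraded 𝒜) (G : Gr 𝒜 M) [Module.Finite A M]
    (h : ∀ (p : Ideal A) (hp : (self 𝒜).IsHomogeneous p), p.IsPrime →
      Module.annihilator A M ≤ p → ((self 𝒜).quot p hp).PoleEqDim) : G.PoleEqDim := by
  have := hA.isNoetherianRing
  -- Noetherian induction on the kernel `U` of a surjection from `M`: a nonzero quotient contains a
  -- shifted copy of some `A ⧸ p` generated by a homogeneous element, and dividing it out strictly
  -- enlarges the kernel. All the primes met contain the annihilator of `M`.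
  have key : ∀ (U : Submodule A M) (N : Type u) [AddCommGroup N] [Module A N] (H : Gr 𝒜 N)
      (g : M →ₗ[A] N), LinearMap.ker g = U → Function.Surjective g → H.PoleEqDim := by
    intro U
    induction U using WellFoundedGT.induction with
    | ind U ih =>
    intro N _ _ H g hU hg hN
    have : Module.Finite A N := Module.Finite.of_surjective g hg
    obtain ⟨j, m, hm, hp⟩ := H.exists_isPrime_ker_toSpanSingleton
    have hhom := H.isHom_toSpanSingleton hm
    set f := LinearMap.toSpanSingleton A N m with hf
    have hker : (self 𝒜).IsHomogeneous (LinearMap.ker f) := by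
      intro i a ha
      have := hhom.isHomogeneous_ker (i + j) a ha
      simpa using this
    have hle : Module.annihilator A M ≤ LinearMap.ker f := fun a ha => by
      obtain ⟨x, hx⟩ := hg m
      rw [LinearMap.mem_ker, hf, LinearMap.toSpanSingleton_apply, ← hx, ← map_smul,
        Module.mem_annihilator.1 ha, map_zero]
    have hhom' : IsHom (((self 𝒜).quot _ hker).shift (-j)) H ((LinearMap.ker f).liftQ f le_rfl)
      := by
      intro i x
      obtain ⟨a, rfl⟩ := Submodule.Quotient.mk_surjective _ x
      exact hhom i a
    have hr := hhom'.isHomogeneous_range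
    refine PoleEqDim.of_exact hA hhom' (H.quot_isHom _ hr)
      (LinearMap.ker_eq_bot.1 (Submodule.ker_liftQ_eq_bot _ _ _ le_rfl))
      (LinearMap.exact_map_mkQ_range _)
      (Submodule.mkQ_surjective _) ((h _ hker hp hle).shift _) ?_ hN
    refine ih (LinearMap.ker ((LinearMap.range ((LinearMap.ker f).liftQ f le_rfl)).mkQ ∘ₗ g)) ?_
      _ _ _ rfl ((Submodule.mkQ_surjective _).comp hg)
    obtain ⟨x, hx⟩ := hg m
    have hm0 : m ≠ 0 := by
      rintro rfl
      exact hp.ne_top (by rw [hf]; simp)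
    refine SetLike.lt_iff_le_and_exists.2 ⟨fun y hy => ?_, x, ?_, ?_⟩
    · rw [← hU, LinearMap.mem_ker] at hy
      rw [LinearMap.mem_ker, LinearMap.comp_apply, hy, map_zero]
    · rw [LinearMap.mem_ker, LinearMap.comp_apply, hx, Submodule.mkQ_apply,
        Submodule.Quotient.mk_eq_zero]
      exact ⟨Submodule.Quotient.mk 1, show f 1 = m from one_smul A m⟩
    · rw [← hU, LinearMap.mem_ker, hx]
      exact hm0
  exact key ⊥ M G LinearMap.id (by simp) Function.surjective_id

/-- The quotient is simple and the class of `1` sits in degree zero, so the cumulative series is `1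
/ (1 - t)`. -/
lemma poleEqDim_of_isMaximal (hA : IsStandardGraded 𝒜) (p : Ideal A) (hp : (self 𝒜).IsHomogeneous p)
    (hmax : p.IsMaximal) : ((self 𝒜).quot p hp).PoleEqDim := by
  intro _
  have := hA.isNoetherianRing
  have hsimple : IsSimpleModule A (A ⧸ p) := isSimpleModule_iff_isCoatom.2 hmax.out
  have hzero : Module.supportDim A (A ⧸ p) = 0 := by
    rw [Module.supportDim_quotient_eq_ringKrullDim]
    exact ringKrullDim_eq_zero_of_isField ((Ideal.Quotient.maximal_ideal_iff_isField_quotient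
      p).1 hmax)
  refine ⟨0, hzero, 1, one_pos, HasPole.of_mul_one_sub ⟨0, 1, ?_, by simp⟩⟩
  have hH : ∀ D : ℤ, ((self 𝒜).quot p hp).hilb D = if 0 ≤ D then 1 else 0 := by
    intro D
    split_ifs with hD
    · have : ((self 𝒜).quot p hp).above D = ⊥ := by
        refine (eq_bot_or_eq_top _).resolve_right fun h => ?_
        have h1 : p.mkQ 1 ∈ ((self 𝒜).quot p hp).above D := by rw [h]; trivial
        have h2 : p.mkQ ((self 𝒜).comp (0 : ℕ) 1) = 0 := h1 (0 : ℕ) hD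
        rw [self_comp_natCast, DirectSum.decompose_of_mem_same 𝒜 SetLike.GradedOne.one_mem,
          Submodule.mkQ_apply, Submodule.Quotient.mk_eq_zero] at h2
        exact hmax.ne_top ((Ideal.eq_top_iff_one p).2 h2)
      rw [hilb, this, LinearEquiv.length_eq (Submodule.quotEquivOfEqBot ⊥ rfl),
        Module.length_eq_one]
      rfl
    · refine hilb_eq_zero _ (eq_top_iff.2 fun x _ j hj => ?_)
      obtain ⟨a, rfl⟩ := Submodule.Quotient.mk_surjective _ x
      change p.mkQ ((self 𝒜).comp j a) = 0
      rw [self_comp_of_neg 𝒜 (by omega), map_zero]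
  ext n
  simp only [pow_zero, map_one, mul_one, one_mul]
  rw [coeff_mul_one_sub_X, coeff_series, coeff_series,
    hH, hH, HahnSeries.coeff_one]
  split_ifs <;> omega

/-- Multiplication by `x` embeds a shift of `A ⧸ p` into itself, so the cokernel has series `(1 -
t)` times that of `A ⧸ p`. The primes in its support strictly contain `p`, so dévissage and `ih`
compute its pole, and `A ⧸ p` has one order more. The lower bound on the dimension prepends `p` to a
chain in the support; the upper bound is the growth estimate. -/
lemma poleEqDim_of_mem_one (hA : IsStandardGraded 𝒜) (p : Ideal A) (hp : (self 𝒜).IsHomogeneous p)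
    (hprime : p.IsPrime) {x : A} (hx : x ∈ 𝒜 1) (hxp : x ∉ p)
    (ih : ∀ (q : Ideal A) (hq : (self 𝒜).IsHomogeneous q), q.IsPrime → p < q →
      ((self 𝒜).quot q hq).PoleEqDim) : ((self 𝒜).quot p hp).PoleEqDim := by
  intro _
  have := hA.isNoetherianRing
  set G := (self 𝒜).quot p hp with hG
  have hxG : IsHom (G.shift (-1)) G (LinearMap.lsmul A (A ⧸ p) x) := by
    intro j m
    rw [LinearMap.lsmul_apply, G.comp_smul' hx, shift_comp, LinearMap.lsmul_apply]
    rfl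
  have hr := hxG.isHomogeneous_range
  set r := LinearMap.range (LinearMap.lsmul A (A ⧸ p) x) with hrdef
  have hinj : Function.Injective (LinearMap.lsmul A (A ⧸ p) x) := by
    rw [injective_iff_map_eq_zero]
    intro m hm
    obtain ⟨a, rfl⟩ := Submodule.Quotient.mk_surjective _ m
    rw [LinearMap.lsmul_apply, ← Submodule.Quotient.mk_smul, Submodule.Quotient.mk_eq_zero] at hm
    rw [Submodule.Quotient.mk_eq_zero]
    exact (hprime.mem_or_mem hm).resolve_left hxp
  have hser := series_exact hA _ _ _ hxG (G.quot_isHom _ hr) hinj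
    (LinearMap.exact_map_mkQ_range _) (Submodule.mkQ_surjective _)
  have hser' : G.series * polyToLaurent (1 - Polynomial.X) = (G.quot r hr).series := by
    rw [series_shift, neg_neg] at hser
    rw [map_sub, map_one, polyToLaurent_X, mul_sub, mul_one, mul_comm G.series]
    exact sub_eq_of_eq_add' hser
  have hann {a : A} (ha : a ∈ p) : a ∈ Module.annihilator A ((A ⧸ p) ⧸ r) := by
    rw [Module.mem_annihilator]
    intro m
    obtain ⟨m, rfl⟩ := Submodule.Quotient.mk_surjective _ m
    obtain ⟨b, rfl⟩ := Submodule.Quotient.mk_surjective _ m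
    rw [← Submodule.Quotient.mk_smul, ← Submodule.Quotient.mk_smul,
      smul_eq_mul, (Submodule.Quotient.mk_eq_zero p).2 (p.mul_mem_right b ha),
        Submodule.Quotient.mk_zero]
  have hannx : x ∈ Module.annihilator A ((A ⧸ p) ⧸ r) := by
    rw [Module.mem_annihilator]
    intro m
    obtain ⟨m, rfl⟩ := Submodule.Quotient.mk_surjective _ m
    rw [← Submodule.Quotient.mk_smul, Submodule.Quotient.mk_eq_zero]
    exact ⟨m, rfl⟩
  have hgood : (G.quot r hr).PoleEqDim := by
    refine poleEqDim_of_primes hA _ fun q hq hqp hle => ih q hq hqp ?_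
    exact SetLike.lt_iff_le_and_exists.2 ⟨fun a ha => hle (hann ha), x, hle hannx, hxp⟩
  -- A multiple of `x`, which has degree one, has no component in degree zero, unlike the class of
  -- `1`.
  have hnt : Nontrivial ((A ⧸ p) ⧸ r) := by
    rw [Submodule.Quotient.nontrivial_iff]
    intro htop
    have h1 : p.mkQ 1 ∈ r := by rw [htop]; trivial
    obtain ⟨m, hm⟩ := h1
    obtain ⟨a, rfl⟩ := Submodule.Quotient.mk_surjective _ m
    have h2 := congrArg (G.comp (0 : ℕ)) hm
    rw [LinearMap.lsmul_apply, G.comp_smul' hx] at h2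
    have h3 : p.mkQ ((self 𝒜).comp (0 : ℕ) 1) = x • p.mkQ ((self 𝒜).comp ((0 : ℕ) - (1 : ℕ)) a) :=
      h2.symm
    rw [self_comp_natCast, DirectSum.decompose_of_mem_same 𝒜 SetLike.GradedOne.one_mem,
      self_comp_of_neg 𝒜 (by norm_num), map_zero, smul_zero, Submodule.mkQ_apply,
      Submodule.Quotient.mk_eq_zero] at h3
    exact hprime.ne_top ((Ideal.eq_top_iff_one p).2 h3)
  obtain ⟨d, hd, q, hq, hpole⟩ := hgood hnt
  rw [← hser'] at hpole
  have hpole' := hpole.of_mul_one_sub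
  refine ⟨d + 1, WithBot.eq_natCast_iff.2 ⟨?_, ?_⟩, q, hq, hpole'⟩
  · rw [Module.le_supportDim_quotient_iff]
    obtain ⟨P, hP, hdP⟩ := Module.le_supportDim_iff.1 hd.ge
    have hle := Module.annihilator_le_of_mem_support hP
    have hlt : (⟨p, hprime⟩ : PrimeSpectrum A) < P :=
      show p < P.asIdeal from
        SetLike.lt_iff_le_and_exists.2 ⟨fun a ha => hle (hann ha), x, hle hannx, hxp⟩
    push_cast
    exact (add_le_add_left hdP 1).trans (Order.coheight_add_one_le hlt)
  · rw [Module.le_supportDim_quotient_iff]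
    exact not_succ_le_coheight_of_hasPole hA ⟨p, hprime⟩ hp hpole'

theorem poleEqDim_prime (hA : IsStandardGraded 𝒜) (p : Ideal A) (hp : (self 𝒜).IsHomogeneous p)
    (hprime : p.IsPrime) : ((self 𝒜).quot p hp).PoleEqDim := by
  have := hA.isNoetherianRing
  induction p using WellFoundedGT.induction with
  | ind p ih =>
  by_cases h : (𝒜 1 : Set A) ⊆ p
  · exact poleEqDim_of_isMaximal hA p hp (hA.isMaximal_of_one_le p h)
  · obtain ⟨x, hx, hxp⟩ := Set.not_subset.1 h
    exact poleEqDim_of_mem_one hA p hp hprime hx hxp fun q hq hq' hlt => ih q hlt hq hq'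

/-- The order of the pole of the cumulative Hilbert series of a nonzero finitely generated graded
module exceeds its Krull dimension by one, and the leading coefficient is positive. -/
theorem poleEqDim (hA : IsStandardGraded 𝒜) (G : Gr 𝒜 M) [Module.Finite A M] : G.PoleEqDim :=
  poleEqDim_of_primes hA G fun p hp hprime _ => poleEqDim_prime hA p hp hprime

end Gr

/-! ### Minimal generators and graded projective modules. -/

namespace Gr

variable {A : Type u} [CommRing A] {𝒜 : ℕ → AddSubgroup A} [GradedRing 𝒜]
variable {M : Type u} [AddCommGroup M] [Module A M]

omit [GradedRing 𝒜] in
/-- `M` has `n` homogeneous generators `e` of degrees `deg`. -/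
def IsGenBy (G : Gr 𝒜 M) {n : ℕ} (e : Fin n → M) (deg : Fin n → ℤ) : Prop :=
  (∀ k, G.comp (deg k) (e k) = e k) ∧ Submodule.span A (Set.range e) = ⊤

omit [GradedRing 𝒜] in
lemma exists_isGenBy (G : Gr 𝒜 M) [Module.Finite A M] :
    ∃ (n : ℕ) (e : Fin n → M) (deg : Fin n → ℤ), G.IsGenBy e deg := by
  classical
  obtain ⟨S, hS⟩ := Module.Finite.fg_top (R := A) (M := M)
  choose s hs using G.exists_sum
  let T : Finset (ℤ × M) := S.biUnion fun m => (s m).image fun j => (j, m)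
  refine ⟨T.card, fun k => G.comp (T.equivFin.symm k).1.1 (T.equivFin.symm k).1.2,
    fun k => (T.equivFin.symm k).1.1, fun k => G.comp_self _ _, ?_⟩
  rw [eq_top_iff, ← hS, Submodule.span_le]
  intro m hm
  rw [SetLike.mem_coe, ← hs m]
  refine Submodule.sum_mem _ fun j hj => Submodule.subset_span ?_
  have hT : (j, m) ∈ T := Finset.mem_biUnion.2 ⟨m, hm, Finset.mem_image_of_mem _ hj⟩
  exact ⟨T.equivFin ⟨_, hT⟩, by simp⟩

/-- The grading of the free module with generators of degrees `deg`. -/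
def free (𝒜 : ℕ → AddSubgroup A) [GradedRing 𝒜] {n : ℕ} (deg : Fin n → ℤ) : Gr 𝒜 (Fin n → A) :=
  pi fun k => (self 𝒜).shift (-deg k)

lemma free_comp {n : ℕ} (deg : Fin n → ℤ) (j : ℤ) (v : Fin n → A) (k : Fin n) :
    (free 𝒜 deg).comp j v k = (self 𝒜).comp (j + -deg k) (v k) := rfl

lemma isHom_linearCombination (G : Gr 𝒜 M) {n : ℕ} {e : Fin n → M} {deg : Fin n → ℤ}
    (h : ∀ k, G.comp (deg k) (e k) = e k) :
    IsHom (free 𝒜 deg) G (Fintype.linearCombination A e) := by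
  intro j v
  rw [Fintype.linearCombination_apply, Fintype.linearCombination_apply, map_sum]
  exact Finset.sum_congr rfl fun k _ => G.isHom_toSpanSingleton (h k) j (v k)

lemma comp_smul_of_homogeneous (G : Gr 𝒜 M) {j : ℤ} {m : M} (hm : G.comp j m = m) (r : A) :
    G.comp j (r • m) = (GradedRing.projZeroRingHom' 𝒜 r : A) • m := by
  have := G.isHom_toSpanSingleton hm j r
  rw [LinearMap.toSpanSingleton_apply, LinearMap.toSpanSingleton_apply, shift_comp, add_neg_cancel,
    ← Nat.cast_zero, self_comp_natCast] at this
  exact this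

lemma isUnit_coe {a : 𝒜 0} (h : IsUnit a) : IsUnit (a : A) :=
  h.map (algebraMap (𝒜 0) A)

/-- If the degree zero part of a coefficient `v k` were a unit, the component of the relation in
degree `deg k` would express `e k` through the other generators, against minimality. -/
lemma coeff_mem_of_minimal [IsLocalRing (𝒜 0)] (G : Gr 𝒜 M) {n : ℕ} {e : Fin n → M}
    {deg : Fin n → ℤ} (h : G.IsGenBy e deg)
    (hmin : ∀ m < n, ∀ (e' : Fin m → M) (deg' : Fin m → ℤ), ¬ G.IsGenBy e' deg')
    {v : Fin n → A} (hv : Fintype.linearCombination A e v = 0) (k : Fin n) :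
    v k ∈ (IsLocalRing.maximalIdeal (𝒜 0)).comap (GradedRing.projZeroRingHom' 𝒜) := by
  obtain _ | n := n
  · exact k.elim0
  by_contra hk
  rw [Ideal.mem_comap, IsLocalRing.mem_maximalIdeal, mem_nonunits_iff, not_not] at hk
  have hu := isUnit_coe hk
  set w := (free 𝒜 deg).comp (deg k) v with hw
  have hwk : w k = (GradedRing.projZeroRingHom' 𝒜 (v k) : A) := by
    rw [hw, free_comp, add_neg_cancel, ← Nat.cast_zero, self_comp_natCast]; rfl
  have hw0 : Fintype.linearCombination A e w = 0 := by
    rw [hw, ← G.isHom_linearCombination h.1, hv, map_zero]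
  rw [Fintype.linearCombination_apply, Fin.sum_univ_succAbove _ k] at hw0
  refine hmin n (by omega) (e ∘ k.succAbove) (deg ∘ k.succAbove) ⟨fun i => h.1 _, ?_⟩
  rw [eq_top_iff, ← h.2, Submodule.span_le]
  rintro _ ⟨i, rfl⟩
  rcases Fin.eq_self_or_eq_succAbove k i with rfl | ⟨i, rfl⟩
  · rw [← hwk] at hu
    have h1 : w i • e i ∈ Submodule.span A (Set.range (e ∘ i.succAbove)) := by
      rw [eq_neg_of_add_eq_zero_left hw0]
      exact Submodule.neg_mem _ (Submodule.sum_mem _ fun l _ =>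
        Submodule.smul_mem _ _ (Submodule.subset_span ⟨l, rfl⟩))
    exact (Submodule.smul_mem_iff_of_isUnit _ hu).1 h1
  · exact Submodule.subset_span ⟨i, rfl⟩

/-- Minimal homogeneous generators of a graded projective module form a basis. -/
lemma injective_of_minimal [IsNoetherianRing A] [IsLocalRing (𝒜 0)] (G : Gr 𝒜 M)
    [Module.Projective A M] {n : ℕ} {e : Fin n → M} {deg : Fin n → ℤ} (h : G.IsGenBy e deg)
    (hmin : ∀ m < n, ∀ (e' : Fin m → M) (deg' : Fin m → ℤ), ¬ G.IsGenBy e' deg') :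
    LinearMap.ker (Fintype.linearCombination A e) = ⊥ := by
  set π := Fintype.linearCombination A e with hπ
  have hsurj : Function.Surjective π := by
    rw [← LinearMap.range_eq_top, Fintype.range_linearCombination, h.2]
  obtain ⟨s, hs⟩ := Module.projective_lifting_property π LinearMap.id hsurj
  set I := (IsLocalRing.maximalIdeal (𝒜 0)).comap (GradedRing.projZeroRingHom' 𝒜) with hI
  -- The splitting `s` makes `id - s ∘ π` a projection onto the kernel. A kernel element is the
  -- combination of the projected basis vectors with its own coordinates, which lie in `I`.
  have hle : LinearMap.ker π ≤ I • LinearMap.ker π := by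
    intro v hv
    have h1 : v = (LinearMap.id - s ∘ₗ π : (Fin n → A) →ₗ[A] (Fin n → A)) v := by
      simp [LinearMap.mem_ker.1 hv]
    rw [h1, LinearMap.pi_apply_eq_sum_univ]
    refine Submodule.sum_mem _ fun k _ => Submodule.smul_mem_smul
      (G.coeff_mem_of_minimal h hmin hv k) ?_
    rw [LinearMap.mem_ker, LinearMap.sub_apply, map_sub, LinearMap.comp_apply]
    have := LinearMap.congr_fun hs (π fun j => if k = j then 1 else 0)
    rw [LinearMap.comp_apply] at this
    rw [this]; simp
  obtain ⟨r, hr, hr0⟩ := Submodule.exists_sub_one_mem_and_smul_eq_zero_of_fg_of_le_smul I _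
    (IsNoetherian.noetherian _) hle
  -- `I` need not lie in the Jacobson radical of `A`, so `r` itself may fail to be a unit. Its
  -- degree zero part is one, and on homogeneous kernel elements only that part contributes in their
  -- own degree.
  have hu : IsUnit (GradedRing.projZeroRingHom' 𝒜 r : A) := by
    apply isUnit_coe
    by_contra hcon
    rw [← mem_nonunits_iff, ← IsLocalRing.mem_maximalIdeal] at hcon
    rw [hI, Ideal.mem_comap, map_sub, map_one] at hr
    have h1 := Ideal.sub_mem _ hcon hr
    rw [sub_sub_cancel] at h1
    exact (Ideal.ne_top_iff_one _).1 (IsLocalRing.maximalIdeal.isMaximal (𝒜 0)).ne_top h1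
  rw [eq_bot_iff]
  intro v hv
  rw [Submodule.mem_bot]
  refine (free 𝒜 deg).eq_zero fun j => ?_
  have h1 := hr0 _ ((G.isHom_linearCombination h.1).isHomogeneous_ker j v hv)
  have h2 := congrArg ((free 𝒜 deg).comp j) h1
  rw [comp_smul_of_homogeneous _ (comp_self _ _ _), map_zero] at h2
  exact (hu.smul_eq_zero).1 h2

end Gr

/-! ### The minimal graded free resolution and its finiteness. -/

/-- A finitely generated graded module. -/
structure GradedModule {A : Type u} [CommRing A] (𝒜 : ℕ → AddSubgroup A) where
  carrier : Type u
  [addCommGroup : AddCommGroup carrier]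
  [module : Module A carrier]
  [finite : Module.Finite A carrier]
  gr : Gr 𝒜 carrier

namespace GradedModule

attribute [instance] addCommGroup module finite

variable {A : Type u} [CommRing A] {𝒜 : ℕ → AddSubgroup A}

open Classical in
/-- The minimal number of homogeneous generators. -/
noncomputable def rank (X : GradedModule 𝒜) : ℕ := Nat.find X.gr.exists_isGenBy

open Classical in
lemma exists_gen (X : GradedModule 𝒜) :
    ∃ (e : Fin X.rank → X.carrier) (deg : Fin X.rank → ℤ), X.gr.IsGenBy e deg :=
  Nat.find_spec X.gr.exists_isGenBy

/-- A minimal system of homogeneous generators. -/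
noncomputable def gen (X : GradedModule 𝒜) : Fin X.rank → X.carrier := X.exists_gen.choose

/-- The degrees of a minimal system of homogeneous generators. -/
noncomputable def deg (X : GradedModule 𝒜) : Fin X.rank → ℤ := X.exists_gen.choose_spec.choose

lemma isGenBy (X : GradedModule 𝒜) : X.gr.IsGenBy X.gen X.deg :=
  X.exists_gen.choose_spec.choose_spec

/-- The minimal graded free cover. -/
noncomputable def coverMap (X : GradedModule 𝒜) : (Fin X.rank → A) →ₗ[A] X.carrier :=
  Fintype.linearCombination A X.gen

lemma coverMap_surjective (X : GradedModule 𝒜) : Function.Surjective X.coverMap := by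
  rw [← LinearMap.range_eq_top, coverMap, Fintype.range_linearCombination, X.isGenBy.2]

variable [GradedRing 𝒜]

lemma isHom_coverMap (X : GradedModule 𝒜) :
    Gr.IsHom (Gr.free 𝒜 X.deg) X.gr X.coverMap := X.gr.isHom_linearCombination X.isGenBy.1

open Classical in
lemma ker_coverMap_eq_bot [IsNoetherianRing A] [IsLocalRing (𝒜 0)] (X : GradedModule 𝒜)
    [Module.Projective A X.carrier] : LinearMap.ker X.coverMap = ⊥ :=
  X.gr.injective_of_minimal X.isGenBy fun _ hm e' deg' h =>
    Nat.find_min X.gr.exists_isGenBy hm ⟨e', deg', h⟩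

variable [IsNoetherianRing A]

/-- The first syzygy module. -/
noncomputable def syzygy (X : GradedModule 𝒜) : GradedModule 𝒜 where
  carrier := LinearMap.ker X.coverMap
  gr := (Gr.free 𝒜 X.deg).sub _ X.isHom_coverMap.isHomogeneous_ker

/-- The inclusion of the syzygy module. -/
noncomputable def incl (X : GradedModule 𝒜) : X.syzygy.carrier →ₗ[A] (Fin X.rank → A) :=
  (LinearMap.ker X.coverMap).subtype

lemma isHom_incl (X : GradedModule 𝒜) : Gr.IsHom X.syzygy.gr (Gr.free 𝒜 X.deg) X.incl :=
  Gr.sub_isHom _ _ X.isHom_coverMap.isHomogeneous_ker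

lemma range_incl (X : GradedModule 𝒜) : LinearMap.range X.incl = LinearMap.ker X.coverMap :=
  Submodule.range_subtype _

lemma incl_injective (X : GradedModule 𝒜) : Function.Injective X.incl :=
  Submodule.subtype_injective _

/-- Iterated syzygies. -/
noncomputable def syz (X : GradedModule 𝒜) : ℕ → GradedModule 𝒜
  | 0 => X
  | i + 1 => (X.syz i).syzygy

/-- The free covers of the iterated syzygies. -/
noncomputable def cover (X : GradedModule 𝒜) (i : ℕ) :
    (Fin (X.syz i).rank → A) →ₗ[A] (X.syz i).carrier := (X.syz i).coverMap

/-- The inclusions of the iterated syzygies. -/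
noncomputable def syzIncl (X : GradedModule 𝒜) (i : ℕ) :
    (X.syz (i + 1)).carrier →ₗ[A] (Fin (X.syz i).rank → A) := (X.syz i).incl

lemma isHom_cover (X : GradedModule 𝒜) (i : ℕ) :
    Gr.IsHom (Gr.free 𝒜 (X.syz i).deg) (X.syz i).gr (X.cover i) := (X.syz i).isHom_coverMap

lemma isHom_syzIncl (X : GradedModule 𝒜) (i : ℕ) :
    Gr.IsHom (X.syz (i + 1)).gr (Gr.free 𝒜 (X.syz i).deg) (X.syzIncl i) := (X.syz i).isHom_incl

lemma cover_surjective (X : GradedModule 𝒜) (i : ℕ) : Function.Surjective (X.cover i) :=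
  (X.syz i).coverMap_surjective

lemma syzIncl_injective (X : GradedModule 𝒜) (i : ℕ) : Function.Injective (X.syzIncl i) :=
  (X.syz i).incl_injective

lemma range_syzIncl (X : GradedModule 𝒜) (i : ℕ) :
    LinearMap.range (X.syzIncl i) = LinearMap.ker (X.cover i) := (X.syz i).range_incl

/-- The differential of the minimal free resolution. -/
noncomputable def diff (X : GradedModule 𝒜) (i : ℕ) :
    (Fin (X.syz (i + 1)).rank → A) →ₗ[A] (Fin (X.syz i).rank → A) :=
  X.syzIncl i ∘ₗ X.cover (i + 1)

lemma isHom_diff (X : GradedModule 𝒜) (i : ℕ) :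
    Gr.IsHom (Gr.free 𝒜 (X.syz (i + 1)).deg) (Gr.free 𝒜 (X.syz i).deg) (X.diff i) :=
  (X.isHom_syzIncl i).comp (X.isHom_cover (i + 1))

lemma range_diff (X : GradedModule 𝒜) (i : ℕ) :
    LinearMap.range (X.diff i) = LinearMap.ker (X.cover i) := by
  rw [diff, LinearMap.range_comp, LinearMap.range_eq_top.2 (X.cover_surjective _),
    Submodule.map_top, range_syzIncl]

lemma ker_diff (X : GradedModule 𝒜) (i : ℕ) :
    LinearMap.ker (X.diff i) = LinearMap.ker (X.cover (i + 1)) :=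
  LinearMap.ker_comp_of_ker_eq_bot _ (LinearMap.ker_eq_bot.2 (X.syzIncl_injective i))

lemma cover_comp_diff (X : GradedModule 𝒜) (i : ℕ) : X.cover i ∘ₗ X.diff i = 0 := by
  rw [← LinearMap.range_le_ker_iff, range_diff]

lemma diff_comp_diff (X : GradedModule 𝒜) (i : ℕ) : X.diff i ∘ₗ X.diff (i + 1) = 0 := by
  rw [← LinearMap.range_le_ker_iff, range_diff, ker_diff]

/-- The minimal graded free resolution. -/
noncomputable def complex (X : GradedModule 𝒜) : ChainComplex (ModuleCat.{u} A) ℕ :=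
  ChainComplex.of (fun i => ModuleCat.of A (Fin (X.syz i).rank → A))
    (fun i => ModuleCat.ofHom (X.diff i))
    (fun i => by rw [← ModuleCat.ofHom_comp, X.diff_comp_diff]; rfl)

lemma complex_d (X : GradedModule 𝒜) (i : ℕ) :
    X.complex.d (i + 1) i = ModuleCat.ofHom (X.diff i) :=
  ChainComplex.of_d (fun i => ModuleCat.of A (Fin (X.syz i).rank → A))
    (fun i => ModuleCat.ofHom (X.diff i)) i

lemma complex_exactAt_succ (X : GradedModule 𝒜) (i : ℕ) : X.complex.ExactAt (i + 1) := by
  rw [HomologicalComplex.exactAt_iff' _ (i + 1 + 1) (i + 1) i (by simp) (by simp)]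
  rw [ShortComplex.moduleCat_exact_iff_range_eq_ker]
  change LinearMap.range (X.complex.d (i + 1 + 1) (i + 1)).hom =
    LinearMap.ker (X.complex.d (i + 1) i).hom
  rw [complex_d, complex_d]
  exact (X.range_diff (i + 1)).trans (X.ker_diff i).symm

lemma complex_d_comp_cover (X : GradedModule 𝒜) :
    X.complex.d 1 0 ≫ (ModuleCat.ofHom (X.cover 0) :
      X.complex.X 0 ⟶ ModuleCat.of A X.carrier) = 0 := by
  rw [complex_d]
  exact ModuleCat.hom_ext (X.cover_comp_diff 0)

/-- The augmentation of the minimal graded free resolution. -/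
noncomputable def augmentation (X : GradedModule 𝒜) :
    X.complex ⟶ (ChainComplex.single₀ (ModuleCat.{u} A)).obj (ModuleCat.of A X.carrier) :=
  (ChainComplex.toSingle₀Equiv _ _).symm ⟨_, X.complex_d_comp_cover⟩

lemma augmentation_f_zero (X : GradedModule 𝒜) :
    X.augmentation.f 0 = ModuleCat.ofHom (X.cover 0) :=
  ChainComplex.toSingle₀Equiv_symm_apply_f_zero _ _

lemma quasiIso_augmentation (X : GradedModule 𝒜) : QuasiIso X.augmentation := ⟨fun n => by
  cases n with
  | zero =>
    rw [ChainComplex.quasiIsoAt₀_iff, ShortComplex.quasiIso_iff_of_zeros']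
    · constructor
      · rw [ShortComplex.moduleCat_exact_iff_range_eq_ker]
        change LinearMap.range (X.complex.d 1 0).hom = LinearMap.ker (X.augmentation.f 0).hom
        rw [complex_d, augmentation_f_zero]
        exact X.range_diff 0
      · rw [ModuleCat.epi_iff_surjective]
        change Function.Surjective (X.augmentation.f 0).hom
        rw [augmentation_f_zero]
        exact X.cover_surjective 0
    all_goals rfl
  | succ n =>
    rw [quasiIsoAt_iff_exactAt']
    · exact X.complex_exactAt_succ n
    · exact ChainComplex.exactAt_succ_single_obj _ _⟩

/-- The minimal graded free resolution, as a projective resolution. -/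
noncomputable def resolution (X : GradedModule 𝒜) :
    ProjectiveResolution (ModuleCat.of A X.carrier) where
  complex := X.complex
  projective n := inferInstanceAs (Projective (ModuleCat.of A (Fin (X.syz n).rank → A)))
  π := X.augmentation
  quasiIso := X.quasiIso_augmentation

lemma hasProjectiveDimensionLE_syzygy (X : GradedModule 𝒜) (n : ℕ)
    (h : HasProjectiveDimensionLE (ModuleCat.of A X.carrier) (n + 1)) :
    HasProjectiveDimensionLE (ModuleCat.of A X.syzygy.carrier) n :=
  (LinearMap.shortExact_shortComplexKer X.coverMap_surjective).hasProjectiveDimensionLT_X₁ (n + 1)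
    (inferInstanceAs (HasProjectiveDimensionLT (ModuleCat.of A (Fin X.rank → A)) (n + 1))) h

/-- Each syzygy lowers the projective dimension by one, so the `n`-th is projective and its minimal
cover is an isomorphism. -/
lemma subsingleton_syz_succ [IsLocalRing (𝒜 0)] (X : GradedModule 𝒜) (n : ℕ)
    (h : HasProjectiveDimensionLE (ModuleCat.of A X.carrier) n) :
    Subsingleton (X.syz (n + 1)).carrier := by
  have key : ∀ k i, k + i = n → HasProjectiveDimensionLE (ModuleCat.of A (X.syz i).carrier) k := by
    intro k i hki
    induction i generalizing k with
    | zero => obtain rfl : k = n := by omega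
              exact h
    | succ i ih => exact hasProjectiveDimensionLE_syzygy _ _ (ih (k + 1) (by omega))
  have h0 := key 0 n (by omega)
  rw [← projective_iff_hasProjectiveDimensionLE_zero, ← IsProjective.iff_projective] at h0
  change Subsingleton (LinearMap.ker (X.syz n).coverMap)
  rw [ker_coverMap_eq_bot]
  infer_instance

omit [GradedRing 𝒜] [IsNoetherianRing A] in
lemma rank_eq_zero (X : GradedModule 𝒜) [Subsingleton X.carrier] : X.rank = 0 := by
  classical
  exact (Nat.find_eq_zero _).2 ⟨Fin.elim0, Fin.elim0, fun k => k.elim0, Subsingleton.elim _ _⟩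

lemma subsingleton_syz_of_lt [IsLocalRing (𝒜 0)] (X : GradedModule 𝒜) {n i : ℕ}
    (h : HasProjectiveDimensionLE (ModuleCat.of A X.carrier) n) (hi : n < i) :
    Subsingleton (X.syz i).carrier := by
  induction i, hi using Nat.le_induction with
  | base => exact X.subsingleton_syz_succ n h
  | succ i _ ih =>
    change Subsingleton (LinearMap.ker (X.syz i).coverMap)
    have : IsEmpty (Fin (X.syz i).rank) := by rw [(X.syz i).rank_eq_zero]; infer_instance
    infer_instance

end GradedModule

/-! ### Series of finite length modules, free modules and their tensor products. -/

section EventuallyConstant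

open Polynomial

/-- Multiplying by `1 - X` leaves finitely many differences of coefficients, and their sum
telescopes to the eventual value. -/
lemma HasPole.of_eventually_eq {f : LaurentSeries ℤ} {q : ℤ}
    (h : ∃ E : ℤ, ∀ n ≥ E, f.coeff n = q) : HasPole f 1 q := by
  obtain ⟨E, hE⟩ := h
  obtain ⟨a, ha⟩ : ∃ a : ℕ, ∀ n : ℤ, n < -a → f.coeff n = 0 := by
    by_cases hf : f = 0
    · exact ⟨0, fun n _ => by rw [hf]; rfl⟩
    · refine ⟨(-f.order).toNat, fun n hn => HahnSeries.coeff_eq_zero_of_lt_order ?_⟩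
      omega
  refine HasPole.of_mul_one_sub ⟨a, ∑ i ∈ Finset.range (E + a + 1).toNat,
    C (f.coeff (i - a) - f.coeff (i - a - 1)) * X ^ i, ?_, ?_⟩
  · ext n
    rw [pow_zero, map_one polyToLaurent, mul_one, polyToLaurent_X_pow a,
      show n = n - a + a by ring, HahnSeries.coeff_single_mul_add, one_mul, coeff_mul_one_sub_X,
      map_sum, HahnSeries.coeff_sum]
    have hC (i : ℕ) (c : ℤ) : polyToLaurent (C c * X ^ i) = HahnSeries.single (i : ℤ) c := by
      have h0 : polyToLaurent (C c) = HahnSeries.single 0 c := by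
        simp only [polyToLaurent, RingHom.comp_apply, Polynomial.coeToPowerSeries.ringHom_apply,
          Polynomial.coe_C, HahnSeries.ofPowerSeries_C, HahnSeries.C_apply]
      rw [map_mul, polyToLaurent_X_pow i, h0, HahnSeries.single_mul_single, zero_add, mul_one]
    simp only [hC, HahnSeries.coeff_single, sub_add_cancel]
    rcases lt_or_ge n 0 with hn | hn
    · refine Eq.trans ?_ (Finset.sum_eq_zero fun i _ => if_neg (by omega)).symm
      rw [ha _ (by omega), ha _ (by omega), sub_zero]
    lift n to ℕ using hn
    simp only [Nat.cast_inj, Finset.sum_ite_eq, Finset.mem_range]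
    split_ifs with h
    · rfl
    · rw [hE _ (by omega), hE _ (by omega), sub_self]
  · simp only [eval_finsetSum, eval_mul, eval_C, eval_pow, eval_X, one_pow, mul_one]
    have := Finset.sum_range_sub (fun i : ℕ => f.coeff (i - a - 1)) (E + a + 1).toNat
    simp only [Nat.cast_add, Nat.cast_one] at this
    rw [← sub_zero q, ← ha (0 - a - 1) (by omega)]
    rcases le_or_gt 0 (E + a + 1) with h0 | h0
    · rw [← hE (((E + a + 1).toNat : ℤ) - a - 1) (by omega)]
      simp only [Nat.cast_zero] at this
      rw [← this]
      refine Finset.sum_congr rfl fun i _ => ?_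
      congr 2; ring
    -- Degenerate case: the coefficients already equal `q` at an index where they vanish, so `q = 0`
    -- and the sum is empty.
    · rw [Int.toNat_of_nonpos h0.le, Finset.sum_range_zero, ha _ (by omega),
        ← hE (-a - 1) (by omega), ha _ (by omega), sub_zero]

end EventuallyConstant

namespace Gr

variable {A : Type u} [CommRing A] {𝒜 : ℕ → AddSubgroup A} [GradedRing 𝒜]
variable {M : Type u} [AddCommGroup M] [Module A M] {N : Type u} [AddCommGroup N] [Module A N]

/-- The descending chain of truncations stabilizes, and its intersection is zero because every
element has finitely many components. -/
lemma exists_above_eq_bot (G : Gr 𝒜 M) [IsArtinian A M] : ∃ E, ∀ D ≥ E, G.above D = ⊥ := by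
  obtain ⟨n, hn⟩ := IsArtinian.monotone_stabilizes (R := A) (M := M)
    ⟨fun n : ℕ => OrderDual.toDual (G.above n), fun i j hij => G.above_antitone (by
      exact_mod_cast hij)⟩
  refine ⟨n, fun D hD => eq_bot_iff.2 fun m hm => ?_⟩
  have hmn : m ∈ G.above n := G.above_antitone hD hm
  obtain ⟨E, hE⟩ := G.exists_comp_eq_zero m
  have h1 : G.above n = G.above (max n E.toNat : ℕ) := hn _ (le_max_left _ _)
  rw [h1] at hmn
  refine (Submodule.mem_bot A).2 (G.eq_zero fun j => ?_)
  rcases le_or_gt j (max n E.toNat : ℕ) with hj | hj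
  · exact hmn j hj
  · refine hE j (lt_of_le_of_lt ?_ hj)
    push_cast
    exact (Int.self_le_toNat E).trans (le_max_right _ _)

/-- The series of a graded module of finite length. -/
lemma hasPole_of_isFiniteLength (G : Gr 𝒜 M) (h : IsFiniteLength A M) :
    HasPole G.series 1 (Module.length A M).toNat := by
  obtain ⟨h1, h2⟩ := isFiniteLength_iff_isNoetherian_isArtinian.1 h
  obtain ⟨E, hE⟩ := G.exists_above_eq_bot
  refine HasPole.of_eventually_eq ⟨E, fun D hD => ?_⟩
  rw [coeff_series, hilb, hE D hD, LinearEquiv.length_eq (Submodule.quotEquivOfEqBot ⊥ rfl)]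

lemma pi_above {n : ℕ} {N : Fin n → Type u} [∀ k, AddCommGroup (N k)] [∀ k, Module A (N k)]
    (G : ∀ k, Gr 𝒜 (N k)) (D : ℤ) :
    (pi G).above D = Submodule.pi Set.univ fun k => (G k).above D := by
  ext v
  simp only [mem_above, Submodule.mem_pi, Set.mem_univ, true_imp_iff, pi_comp]
  exact ⟨fun h k j hj => congrFun (h j hj) k, fun h j hj => funext fun k => h k j hj⟩

lemma series_pi (hA : IsStandardGraded 𝒜) {n : ℕ} {N : Fin n → Type u} [∀ k, AddCommGroup (N k)]
    [∀ k, Module A (N k)] [∀ k, Module.Finite A (N k)] (G : ∀ k, Gr 𝒜 (N k)) :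
    (pi G).series = ∑ k, (G k).series := by
  classical
  ext D
  rw [HahnSeries.coeff_sum, coeff_series]
  simp only [coeff_series]
  have : ((pi G).hilb D : ℕ∞) = ∑ k, ((G k).hilb D : ℕ∞) := by
    simp only [natCast_hilb hA]
    rw [pi_above, LinearEquiv.length_eq (Submodule.quotientPi _), Module.length_pi_of_fintype]
  exact_mod_cast this

/-- The numerator of the Hilbert series of a graded free module. -/
noncomputable def shifts {n : ℕ} (deg : Fin n → ℤ) : LaurentSeries ℤ :=
  ∑ k, HahnSeries.single (deg k) 1

lemma series_free (hA : IsStandardGraded 𝒜) {n : ℕ} (deg : Fin n → ℤ) :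
    (free 𝒜 deg).series = shifts deg * (self 𝒜).series := by
  rw [free, series_pi hA, shifts, Finset.sum_mul]
  simp only [series_shift, neg_neg]

lemma comp_smul_comp (H : Gr 𝒜 N) (a : A) (n : N) (d i j : ℤ) :
    H.comp d ((self 𝒜).comp i a • H.comp j n) =
      if d = i + j then (self 𝒜).comp i a • H.comp j n else 0 := by
  rcases lt_or_ge i 0 with hi | hi
  · rw [self_comp_of_neg 𝒜 hi]; simp
  · lift i to ℕ using hi
    rw [self_comp_natCast, H.comp_smul' (SetLike.coe_mem _), H.comp_comp]
    by_cases h : d = i + j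
    · rw [if_pos h, if_pos (by omega)]
    · rw [if_neg h, if_neg (by omega), smul_zero]

/-- Tensoring with a finite free module. -/
noncomputable def piTensorEquiv (A N : Type u) [CommRing A] [AddCommGroup N] [Module A N] (n : ℕ) :
    (Fin n → A) ⊗[A] N ≃ₗ[A] (Fin n → N) :=
  TensorProduct.comm A _ _ ≪≫ₗ TensorProduct.piScalarRight A A N (Fin n)

lemma piTensorEquiv_tmul {n : ℕ} (v : Fin n → A) (x : N) (k : Fin n) :
    piTensorEquiv A N n (v ⊗ₜ x) k = v k • x := by
  simp [piTensorEquiv]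

lemma series_free_tensor (hA : IsStandardGraded 𝒜) {n : ℕ} (deg : Fin n → ℤ) (H : Gr 𝒜 N)
    [Module.Finite A N] : (tensor (free 𝒜 deg) H).series = shifts deg * H.series := by
  have he : IsHom (tensor (free 𝒜 deg) H) (pi fun k => H.shift (-deg k))
      (piTensorEquiv A N n : (Fin n → A) ⊗[A] N →ₗ[A] (Fin n → N)) := by
    intro d x
    induction x using tensor_induction (free 𝒜 deg) H with
    | h0 => simp only [map_zero]
    | h1 i j v x =>
      rw [tensor_comp_tmul]
      ext k
      rw [LinearEquiv.coe_coe]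
      change H.comp (d + -deg k) (piTensorEquiv A N n _ k) = _
      rw [piTensorEquiv_tmul, free_comp, comp_smul_comp]
      by_cases h : d = i + j
      · rw [if_pos h, if_pos (by omega), piTensorEquiv_tmul, free_comp]
      · rw [if_neg h, if_neg (by omega), map_zero]; rfl
    | h2 x y hx hy => simp only [map_add, hx, hy]
  rw [series_congr _ _ _ he, series_pi hA, shifts, Finset.sum_mul]
  simp only [series_shift, neg_neg]

end Gr

/-! ### Euler characteristic identities for series. -/

namespace GradedModule

variable {A : Type u} [CommRing A] {𝒜 : ℕ → AddSubgroup A} [GradedRing 𝒜] [IsNoetherianRing A]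

lemma series_syz (hA : IsStandardGraded 𝒜) (X : GradedModule 𝒜) (i : ℕ) :
    (Gr.free 𝒜 (X.syz i).deg).series = (X.syz (i + 1)).gr.series + (X.syz i).gr.series :=
  Gr.series_exact hA _ _ _ (X.isHom_syzIncl i) (X.isHom_cover i) (X.syzIncl_injective i)
    (LinearMap.exact_iff.2 (X.range_syzIncl i).symm) (X.cover_surjective i)

/-- Additivity along the first `n` syzygy sequences; the last term vanishes once the resolution has
stopped. -/
lemma series_eq_sum (hA : IsStandardGraded 𝒜) (X : GradedModule 𝒜) (n : ℕ) :
    X.gr.series = (∑ i ∈ Finset.range n, (-1) ^ i * Gr.shifts (X.syz i).deg) * (Gr.self 𝒜).series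
      + (-1) ^ n * (X.syz n).gr.series := by
  induction n with
  | zero =>
    simp only [Finset.range_zero, Finset.sum_empty, zero_mul, pow_zero, one_mul, zero_add]
    rfl
  | succ n ih =>
    have h := X.series_syz hA n
    rw [Gr.series_free hA] at h
    rw [ih, Finset.sum_range_succ, add_mul, mul_assoc _ (Gr.shifts _), h]
    ring

end GradedModule

namespace Gr

variable {A : Type u} [CommRing A] {𝒜 : ℕ → AddSubgroup A} [GradedRing 𝒜] [IsNoetherianRing A]
variable {M : Type u} [AddCommGroup M] [Module A M]
  {M' : Type u} [AddCommGroup M'] [Module A M'] {M'' : Type u} [AddCommGroup M''] [Module A M'']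

lemma series_ker_add_range (hA : IsStandardGraded 𝒜) {G : Gr 𝒜 M} {G' : Gr 𝒜 M'}
    [Module.Finite A M] [Module.Finite A M'] {f : M →ₗ[A] M'} (hf : IsHom G G' f) :
    G.series = (G.sub _ hf.isHomogeneous_ker).series + (G'.sub _ hf.isHomogeneous_range).series :=
  series_exact hA _ _ _ (G.sub_isHom _ hf.isHomogeneous_ker)
    (g := f.rangeRestrict) (fun j m => Subtype.ext (hf j m)) (Submodule.subtype_injective _)
    (fun m => by
      rw [Submodule.coe_subtype, Subtype.range_coe_subtype]
      simp [Subtype.ext_iff])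
    f.surjective_rangeRestrict

/-- The kernel of `g` is an extension of the homology by the range of `f`, and `M'` is an extension
of the range of `g` by that kernel. -/
lemma exists_homology (hA : IsStandardGraded 𝒜) {G : Gr 𝒜 M} {G' : Gr 𝒜 M'} {G'' : Gr 𝒜 M''}
    [Module.Finite A M] [Module.Finite A M'] [Module.Finite A M'']
    {f : M →ₗ[A] M'} {g : M' →ₗ[A] M''} (hf : IsHom G G' f) (hg : IsHom G' G'' g)
    (h : ∀ m, f m ∈ LinearMap.ker g) :
    ∃ H : Gr 𝒜 (LinearMap.ker g ⧸ LinearMap.range (f.codRestrict (LinearMap.ker g) h)),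
      G'.series = H.series + (G'.sub _ hf.isHomogeneous_range).series +
        (G''.sub _ hg.isHomogeneous_range).series := by
  set f' := f.codRestrict (LinearMap.ker g) h with hf'
  have hhom : IsHom G (G'.sub _ hg.isHomogeneous_ker) f' := fun j m => Subtype.ext (hf j m)
  refine ⟨(G'.sub _ hg.isHomogeneous_ker).quot _ hhom.isHomogeneous_range, ?_⟩
  have h1 := series_exact hA _ _ _
    ((G'.sub _ hg.isHomogeneous_ker).sub_isHom _ hhom.isHomogeneous_range)
    ((G'.sub _ hg.isHomogeneous_ker).quot_isHom _ hhom.isHomogeneous_range)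
    (Submodule.subtype_injective _) (LinearMap.exact_subtype_mkQ _) (Submodule.mkQ_surjective _)
  have h2 : (G'.sub _ hf.isHomogeneous_range).series =
      ((G'.sub _ hg.isHomogeneous_ker).sub _ hhom.isHomogeneous_range).series := by
    have h3 := series_exact hA _ _ ((G'.sub _ hg.isHomogeneous_ker).sub _ hhom.isHomogeneous_range)
      (G.sub_isHom _ hf.isHomogeneous_ker) (g := f'.rangeRestrict)
      (fun j m => Subtype.ext (hhom j m)) (Submodule.subtype_injective _)
      (fun m => by
        rw [Submodule.coe_subtype, Subtype.range_coe_subtype]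
        simp [Subtype.ext_iff, hf'])
      f'.surjective_rangeRestrict
    exact add_left_cancel ((series_ker_add_range hA hf).symm.trans h3)
  rw [series_ker_add_range hA hg, h1, h2]
  ring

end Gr

/-! ### Tor: annihilators, finite length, gradings. -/

section Tor

variable {A : Type u} [CommRing A] {M N : Type u} [AddCommGroup M] [Module A M]
  [AddCommGroup N] [Module A N]

/-- After base change to the residue field at `p` this says that a tensor product of nonzero vector
spaces is nonzero. -/
lemma Module.mem_support_tensorProduct [Module.Finite A M] [Module.Finite A N]
    {p : PrimeSpectrum A} (hM : p ∈ Module.support A M) (hN : p ∈ Module.support A N) :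
    p ∈ Module.support A (M ⊗[A] N) := by
  rw [Module.mem_support_iff_nontrivial_residueField_tensorProduct] at hM hN ⊢
  have := hM
  have := hN
  exact (TensorProduct.AlgebraTensorModule.distribBaseChange A
    p.asIdeal.ResidueField M N).toEquiv.nontrivial

/-- Along a composition series, the prime contains the product of the annihilators of the simple
factors, hence one of them, and these are maximal. -/
lemma IsFiniteLength.isMaximal_of_annihilator_le (h : IsFiniteLength A M) {P : Ideal A}
    [P.IsPrime] (hP : Module.annihilator A M ≤ P) : P.IsMaximal := by
  induction h with
  | of_subsingleton =>
    rw [Module.annihilator_eq_top_iff.2 ‹_›, top_le_iff] at hP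
    exact absurd hP (Ideal.IsPrime.ne_top ‹_›)
  | @of_simple_quotient M _ _ N _ _ ih =>
    have hmul : Module.annihilator A N * Module.annihilator A (M ⧸ N) ≤ P := by
      refine le_trans (Ideal.mul_le.2 fun r hr s hs => ?_) hP
      rw [Module.mem_annihilator] at hr hs ⊢
      intro m
      have h1 : s • m ∈ N := by
        rw [← Submodule.Quotient.mk_eq_zero, Submodule.Quotient.mk_smul, hs]
      rw [mul_smul]
      exact congrArg Subtype.val (hr ⟨s • m, h1⟩)
    rcases (Ideal.IsPrime.mul_le ‹_›).1 hmul with h1 | h1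
    · exact ih h1
    · have hmax : (Module.annihilator A (M ⧸ N)).IsMaximal :=
        IsSimpleModule.annihilator_isMaximal
      rwa [← hmax.eq_of_le (Ideal.IsPrime.ne_top ‹_›) h1]

/-- Multiplication by a scalar on a left derived functor of a linear functor. -/
lemma ProjectiveResolution.leftDerived_map_smul_id (F : ModuleCat.{u} A ⥤ ModuleCat.{u} A)
    [F.Additive] [F.Linear A] (n : ℕ) (X : ModuleCat.{u} A) (a : A) :
    (F.leftDerived n).map (a • 𝟙 X) = a • 𝟙 _ := by
  let P := projectiveResolution X
  rw [← cancel_mono (P.isoLeftDerivedObj F n).hom,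
    CategoryTheory.ProjectiveResolution.isoLeftDerivedObj_hom_naturality (a • 𝟙 X)
      P P (a • 𝟙 P.complex)
      (((Linear.smul_comp _ _ _ a (𝟙 _) (P.π.f 0)).trans
        (congrArg (a • ·) ((Category.id_comp _).trans (Category.comp_id _).symm))).trans
        (Linear.comp_smul _ _ _ (P.π.f 0) a (𝟙 X)).symm) F n,
    Functor.comp_map, Functor.map_smul, CategoryTheory.Functor.map_id]
  have : (HomologicalComplex.homologyFunctor (ModuleCat.{u} A) (ComplexShape.down ℕ) n).map
      (a • 𝟙 ((F.mapHomologicalComplex _).obj P.complex)) = a • 𝟙 _ := by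
    refine (ShortComplex.homologyMap_smul
      (𝟙 (((F.mapHomologicalComplex _).obj P.complex).sc n)) a).trans ?_
    rw [ShortComplex.homologyMap_id]
    rfl
  rw [this, Linear.comp_smul, Linear.smul_comp, Category.comp_id, Category.id_comp]

/-- Multiplication by `a` on Tor is induced by multiplication by `a` on the first argument, which is
the zero map. -/
lemma smul_torModule_eq_zero {a : A} (ha : ∀ m : M, a • m = 0) (i : ℕ)
    (x : torModule A M N i) : a • x = 0 := by
  have h := ProjectiveResolution.leftDerived_map_smul_id
    ((MonoidalCategory.tensoringRight (ModuleCat.{u} A)).obj (ModuleCat.of A N)) i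
    (ModuleCat.of A M) a
  have h0 : a • 𝟙 (ModuleCat.of A M) = 0 := by
    ext m; exact ha m
  rw [h0] at h
  have h1 : ((((MonoidalCategory.tensoringRight (ModuleCat.{u} A)).obj
      (ModuleCat.of A N)).leftDerived i).map (0 : ModuleCat.of A M ⟶ ModuleCat.of A M)) = 0 := by
    have := ProjectiveResolution.leftDerived_map_smul_id
      ((MonoidalCategory.tensoringRight (ModuleCat.{u} A)).obj (ModuleCat.of A N)) i
      (ModuleCat.of A M) 0
    rwa [zero_smul, zero_smul] at this
  exact (congrArg (fun φ => φ.hom x) (h1.symm.trans h)).symm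

/-- The homology of `M →f M' →g M''` at `M'`. -/
abbrev LinearMap.Homology {M' M'' : Type u} [AddCommGroup M'] [Module A M'] [AddCommGroup M'']
    [Module A M''] (f : M →ₗ[A] M') (g : M' →ₗ[A] M'') (h : ∀ m, f m ∈ LinearMap.ker g) : Type u :=
  LinearMap.ker g ⧸ LinearMap.range (f.codRestrict (LinearMap.ker g) h)

lemma ChainComplex.nonempty_homology_equiv (K : ChainComplex (ModuleCat.{u} A) ℕ) {i j k : ℕ}
    (hi : (ComplexShape.down ℕ).prev j = i) (hk : (ComplexShape.down ℕ).next j = k)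
    {f : K.X i →ₗ[A] K.X j} {g : K.X j →ₗ[A] K.X k} (hf : (K.d i j).hom = f)
    (hg : (K.d j k).hom = g) :
    ∃ h : ∀ x, f x ∈ LinearMap.ker g, Nonempty (K.homology j ≃ₗ[A] LinearMap.Homology f g h) := by
  subst hf hg
  exact ⟨fun x => (K.sc' i j k).moduleCat_zero_apply x,
    ⟨(ShortComplex.homologyMapIso (K.isoSc' i j k hi hk) ≪≫
      (K.sc' i j k).moduleCatHomologyIso).toLinearEquiv⟩⟩

end Tor

namespace GradedModule

variable {A : Type u} [CommRing A] {𝒜 : ℕ → AddSubgroup A} [GradedRing 𝒜] [IsNoetherianRing A]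
variable (X : GradedModule 𝒜) (N : Type u) [AddCommGroup N] [Module A N]

/-- The resolution tensored with `N`. -/
noncomputable def tensorComplex : ChainComplex (ModuleCat.{u} A) ℕ :=
  (((MonoidalCategory.tensoringRight (ModuleCat.{u} A)).obj
    (ModuleCat.of A N)).mapHomologicalComplex _).obj X.complex

lemma tensorComplex_d (i : ℕ) :
    ((X.tensorComplex N).d (i + 1) i).hom = (X.diff i).rTensor N := by
  change ((((MonoidalCategory.tensoringRight (ModuleCat.{u} A)).obj
    (ModuleCat.of A N)).map (X.complex.d (i + 1) i))).hom = _
  rw [X.complex_d]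
  rfl

/-- The differential of the resolution going out of degree `i`. -/
noncomputable def diffFrom : (i : ℕ) →
    (Fin (X.syz i).rank → A) →ₗ[A] (Fin (X.syz (i - 1)).rank → A)
  | 0 => 0
  | i + 1 => X.diff i

lemma isHom_diffFrom (i : ℕ) :
    Gr.IsHom (Gr.free 𝒜 (X.syz i).deg) (Gr.free 𝒜 (X.syz (i - 1)).deg) (X.diffFrom i) := by
  cases i with
  | zero => exact Gr.isHom_zero _ _
  | succ i => exact X.isHom_diff i

lemma nonempty_torModule_equiv (i : ℕ) :
    ∃ h : ∀ x, (X.diff i).rTensor N x ∈ LinearMap.ker ((X.diffFrom i).rTensor N),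
    Nonempty (torModule A X.carrier N i ≃ₗ[A]
      LinearMap.Homology ((X.diff i).rTensor N) ((X.diffFrom i).rTensor N) h) := by
  have hg : ((X.tensorComplex N).d i (i - 1)).hom = (X.diffFrom i).rTensor N := by
    cases i with
    | zero =>
      rw [(X.tensorComplex N).shape _ _ (by simp)]
      exact (LinearMap.rTensor_zero N).symm
    | succ i => exact X.tensorComplex_d N i
  obtain ⟨h, ⟨e⟩⟩ := ChainComplex.nonempty_homology_equiv (X.tensorComplex N)
    (ChainComplex.prev ℕ i) (by cases i <;> simp) (X.tensorComplex_d N i) hg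
  exact ⟨h, ⟨(X.resolution.isoLeftDerivedObj _ i).toLinearEquiv ≪≫ₗ e⟩⟩

end GradedModule

namespace GradedModule

variable {A : Type u} [CommRing A] {𝒜 : ℕ → AddSubgroup A} [GradedRing 𝒜] [IsNoetherianRing A]
variable (X : GradedModule 𝒜) {N : Type u} [AddCommGroup N] [Module A N]

/-- The series of the boundaries of the resolution tensored with a graded module. -/
noncomputable def boundarySeries (H : Gr 𝒜 N) : ℕ → LaurentSeries ℤ
  -- The index is that of the source of the differential: the value at `i + 1` belongs to the image
  -- of `F_{i+1} ⊗ N` in `F_i ⊗ N`.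
  | 0 => 0
  | i + 1 => (Gr.sub (Gr.tensor (Gr.free 𝒜 (X.syz i).deg) H) _
      ((X.isHom_diff i).rTensor H).isHomogeneous_range).series

lemma finite_torModule [Module.Finite A N] (i : ℕ) :
    Module.Finite A (torModule A X.carrier N i) := by
  obtain ⟨h, ⟨e⟩⟩ := X.nonempty_torModule_equiv N i
  exact Module.Finite.equiv e.symm

/-- For scalars killing the second argument it is enough to look at the tensored resolution, whose
terms `F_i ⊗ N` they already kill. -/
lemma smul_torModule_eq_zero {a : A} (ha : ∀ x : N, a • x = 0) (i : ℕ)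
    (x : torModule A X.carrier N i) : a • x = 0 := by
  obtain ⟨h, ⟨e⟩⟩ := X.nonempty_torModule_equiv N i
  have hz (y : (Fin (X.syz i).rank → A) ⊗[A] N) : a • y = 0 := by
    induction y with
    | zero => exact smul_zero a
    | tmul v y => rw [← TensorProduct.tmul_smul, ha, TensorProduct.tmul_zero]
    | add y z hy hz => rw [smul_add, hy, hz, add_zero]
  refine e.injective ?_
  rw [map_smul, map_zero]
  obtain ⟨y, hy⟩ := Submodule.Quotient.mk_surjective _ (e x)
  rw [← hy, ← Submodule.Quotient.mk_smul, show a • y = 0 from Subtype.ext (hz y),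
    Submodule.Quotient.mk_zero]

/-- Tor inherits a grading as the homology of `F ⊗ N`, whose differentials are homogeneous; the
series of `F_i ⊗ N` splits into homology, incoming boundaries and outgoing image. -/
lemma exists_torModule_series (hA : IsStandardGraded 𝒜) [Module.Finite A N] (H : Gr 𝒜 N) (i : ℕ) :
    ∃ T : Gr 𝒜 (torModule A X.carrier N i), Gr.shifts (X.syz i).deg * H.series =
      T.series + X.boundarySeries H (i + 1) + X.boundarySeries H i := by
  obtain ⟨h, ⟨e⟩⟩ := X.nonempty_torModule_equiv N i
  obtain ⟨T, hT⟩ := Gr.exists_homology hA ((X.isHom_diff i).rTensor H)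
    ((X.isHom_diffFrom i).rTensor H) h
  refine ⟨T.congr e.symm, ?_⟩
  rw [Gr.series_congr T (T.congr e.symm) e.symm fun j m => by simp] at hT
  rw [← Gr.series_free_tensor hA, hT]
  congr 1
  cases i with
  | zero =>
    have : Subsingleton (LinearMap.range ((X.diffFrom 0).rTensor N)) := by
      rw [show X.diffFrom 0 = 0 from rfl, LinearMap.rTensor_zero, LinearMap.range_zero]
      infer_instance
    exact Gr.series_eq_zero _
  | succ i => rfl

lemma boundarySeries_eq_zero (H : Gr 𝒜 N) {i : ℕ} [Subsingleton (X.syz i).carrier] :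
    X.boundarySeries H (i + 1) = 0 := by
  have : IsEmpty (Fin (X.syz i).rank) := by rw [(X.syz i).rank_eq_zero]; infer_instance
  have : Subsingleton ((Fin (X.syz i).rank → A) ⊗[A] N) :=
    (Gr.piTensorEquiv A N _).toEquiv.subsingleton
  exact Gr.series_eq_zero _

lemma subsingleton_torModule {i : ℕ} [Subsingleton (X.syz i).carrier] :
    Subsingleton (torModule A X.carrier N i) := by
  obtain ⟨h, ⟨e⟩⟩ := X.nonempty_torModule_equiv N i
  have : IsEmpty (Fin (X.syz i).rank) := by rw [(X.syz i).rank_eq_zero]; infer_instance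
  have : Subsingleton ((Fin (X.syz i).rank → A) ⊗[A] N) :=
    (Gr.piTensorEquiv A N _).toEquiv.subsingleton
  exact e.toEquiv.subsingleton

/-- In the alternating sum each boundary series occurs in two consecutive degrees with opposite
signs; only the last one remains. -/
lemma sum_shifts_mul_series {T : ∀ i, Gr 𝒜 (torModule A X.carrier N i)} (H : Gr 𝒜 N)
    (hT : ∀ i, Gr.shifts (X.syz i).deg * H.series =
      (T i).series + X.boundarySeries H (i + 1) + X.boundarySeries H i) (n : ℕ) :
    (∑ i ∈ Finset.range n, (-1) ^ i * Gr.shifts (X.syz i).deg) * H.series =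
      ∑ i ∈ Finset.range n, (-1) ^ i * (T i).series - (-1) ^ n * X.boundarySeries H n := by
  induction n with
  | zero => simp [boundarySeries]
  | succ n ih =>
    rw [Finset.sum_range_succ, Finset.sum_range_succ, add_mul, ih, mul_assoc _ (Gr.shifts _), hT]
    ring

/-- Tor is killed by the annihilators of both modules, so any prime over its annihilator lies in
both supports, hence in the support of `M ⊗ N`, and is maximal. -/
lemma isFiniteLength_torModule [Module.Finite A N] (h : IsFiniteLength A (X.carrier ⊗[A] N))
    (i : ℕ) : IsFiniteLength A (torModule A X.carrier N i) := by
  have := X.finite_torModule (N := N) i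
  refine isFiniteLength_of_forall_isMaximal fun P hP hle => ?_
  have hM : Module.annihilator A X.carrier ≤ P := fun a ha => hle <|
    Module.mem_annihilator.2 fun x => _root_.smul_torModule_eq_zero (Module.mem_annihilator.1 ha)
      i x
  have hN : Module.annihilator A N ≤ P := fun a ha => hle <|
    Module.mem_annihilator.2 fun x => X.smul_torModule_eq_zero (Module.mem_annihilator.1 ha) i x
  have := Module.mem_support_tensorProduct (p := ⟨P, hP⟩)
    (Module.mem_support_iff_of_finite.2 hM) (Module.mem_support_iff_of_finite.2 hN)
  exact h.isMaximal_of_annihilator_le (Module.mem_support_iff_of_finite.1 this)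

end GradedModule

/-! ### Comparison of poles and the theorem. -/

lemma intersectionMultiplicity_eq_sum {A M N : Type u} [CommRing A] [AddCommGroup M] [Module A M]
    [AddCommGroup N] [Module A N] {n : ℕ}
    (h : ∀ i, n ≤ i → Subsingleton (torModule A M N i)) :
    intersectionMultiplicity A M N =
      ∑ i ∈ Finset.range n, (-1 : ℤ) ^ i * ((Module.length A (torModule A M N i)).toNat : ℤ) := by
  refine finsum_eq_sum_of_support_subset _ fun i hi => ?_
  rw [Finset.coe_range, Set.mem_Iio]
  by_contra! hni
  have := h i hni
  exact hi (by simp [Module.length_eq_zero])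

lemma HasPole.sum_alternating {f : ℕ → LaurentSeries ℤ} {d : ℕ} {q : ℕ → ℤ}
    (h : ∀ i, HasPole (f i) d (q i)) (n : ℕ) :
    HasPole (∑ i ∈ Finset.range n, (-1) ^ i * f i) d (∑ i ∈ Finset.range n, (-1) ^ i * q i) := by
  induction n with
  | zero => exact HasPole.zero d
  | succ n ih =>
    rw [Finset.sum_range_succ, Finset.sum_range_succ]
    refine ih.add ?_
    rcases n.even_or_odd with hn | hn
    · simpa only [hn.neg_one_pow, one_mul] using h n
    · simpa only [hn.neg_one_pow, neg_one_mul] using (h n).neg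

/-- Both sides are read at the larger of the orders `m + n + 2` and `d + 2`, where leading
coefficients are unique. The left one, `p * q`, is nonzero, so `m + n > d` is impossible; `m + n <
d` forces `r * c = 0`, and equality gives `r * c = p * q > 0`. -/
lemma HasPole.compare {f g a s : LaurentSeries ℤ} {m n d : ℕ} {p q r c : ℤ}
    (hf : HasPole f (m + 1) p) (hg : HasPole g (n + 1) q) (ha : HasPole a (d + 1) r)
    (hs : HasPole s 1 c) (h : f * g = a * s) (hp : 0 < p) (hq : 0 < q) (hr : 0 < r) :
    m + n ≤ d ∧ 0 ≤ c ∧ (0 < c ↔ m + n = d) := by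
  have h1 := hf.mul hg
  have h2 := ha.mul hs
  rw [← h] at h2
  have hpq : 0 < p * q := mul_pos hp hq
  rcases lt_trichotomy (m + n) d with hlt | heq | hgt
  · have h3 := h2.unique (h1.of_lt (by omega))
    have hc : c = 0 := (mul_eq_zero.1 h3).resolve_left hr.ne'
    subst hc
    exact ⟨hlt.le, le_rfl, by simp [hlt.ne]⟩
  · have h3 : r * c = p * q := h2.unique (by convert h1 using 1; omega)
    have hc : 0 < c := pos_of_mul_pos_right (h3 ▸ hpq) hr.le
    exact ⟨heq.le, hc.le, by simp [hc, heq]⟩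
  · exact absurd (h1.unique (h2.of_lt (by omega))) hpq.ne'

theorem mainTheorem2 {A : Type u} [CommRing A] (𝒜 : ℕ → AddSubgroup A) [GradedRing 𝒜]
    (hA : IsStandardGraded 𝒜)
    {M : Type u} [AddCommGroup M] [Module A M] [Module.Finite A M] [Nontrivial M]
    (ℳ : ℤ → AddSubgroup M) (hℳ : IsGradedModuleOver 𝒜 ℳ)
    {N : Type u} [AddCommGroup N] [Module A N] [Module.Finite A N]
    (𝒩 : ℤ → AddSubgroup N) (h𝒩 : IsGradedModuleOver 𝒜 𝒩)
    (hpd : HasFiniteProjDim A M)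
    (hfl : IsFiniteLength A (M ⊗[A] N)) :
    ((∀ i : ℕ, IsFiniteLength A (torModule A M N i)) ∧
      (∃ n : ℕ, ∀ i : ℕ, n < i → Subsingleton (torModule A M N i))) ∧
    Module.supportDim A M + Module.supportDim A N ≤ ringKrullDim A ∧
    0 ≤ intersectionMultiplicity A M N ∧
    (0 < intersectionMultiplicity A M N ↔
      Module.supportDim A M + Module.supportDim A N = ringKrullDim A) := by
  have := hA.isNoetherianRing
  have := hA.isLocalRing_zero
  have : Nontrivial A := Module.nontrivial A M
  obtain ⟨G⟩ := Gr.nonempty_of_isGradedModuleOver hℳ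
  obtain ⟨H⟩ := Gr.nonempty_of_isGradedModuleOver h𝒩
  obtain ⟨n, hn⟩ := hpd
  let X : GradedModule 𝒜 := { carrier := M, gr := G }
  have hsyz (i : ℕ) (hi : n < i) : Subsingleton (X.syz i).carrier := X.subsingleton_syz_of_lt hn hi
  have hlen (i : ℕ) : IsFiniteLength A (torModule A M N i) := X.isFiniteLength_torModule hfl i
  have hvan (i : ℕ) (hi : n < i) : Subsingleton (torModule A M N i) := by
    have := hsyz i hi
    exact X.subsingleton_torModule
  refine ⟨⟨hlen, n, hvan⟩, ?_⟩
  rcases subsingleton_or_nontrivial N with hN | hN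
  · have hz : intersectionMultiplicity A M N = 0 := by
      refine (intersectionMultiplicity_eq_sum (n := 0) fun i _ => ⟨fun x y => ?_⟩).trans
        (Finset.sum_range_zero _)
      have h (z : torModule A M N i) : z = 0 := by
        rw [← one_smul A z]
        exact X.smul_torModule_eq_zero (fun x : N => Subsingleton.elim _ _) i z
      rw [h x, h y]
    rw [Module.supportDim_eq_bot_of_subsingleton A N, WithBot.add_bot, hz]
    exact ⟨bot_le, le_rfl, by
      simpa using (ringKrullDim_nonneg_of_nontrivial (R := A)).trans_lt' (WithBot.bot_lt_coe 0)
        |>.ne⟩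
  obtain ⟨dM, hdM, p, hp, hpM⟩ := G.poleEqDim hA ‹_›
  obtain ⟨dN, hdN, q, hq, hqN⟩ := H.poleEqDim hA ‹_›
  obtain ⟨d, hd, r, hr, hrA⟩ := (Gr.self 𝒜).poleEqDim hA ‹_›
  rw [Module.supportDim_self_eq_ringKrullDim] at hd
  choose T hT using X.exists_torModule_series hA H
  have hsub := hsyz (n + 1) (by omega)
  have hsub' := hsyz (n + 2) (by omega)
  -- Summing up to `n + 2` kills both remainders: the syzygy of index `n + 2`, and the boundaries
  -- inside `F_{n+1} ⊗ N`, which vanish since the syzygy of index `n + 1` is zero.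
  have h1 := X.series_eq_sum hA (n + 2)
  rw [(X.syz (n + 2)).gr.series_eq_zero, mul_zero, add_zero] at h1
  have h2 := X.sum_shifts_mul_series H hT (n + 2)
  rw [X.boundarySeries_eq_zero, mul_zero, sub_zero] at h2
  have hs := HasPole.sum_alternating (fun i => (T i).hasPole_of_isFiniteLength (hlen i)) (n + 2)
  rw [← intersectionMultiplicity_eq_sum fun i hi => hvan i (by omega)] at hs
  -- Eliminate the numerator of the resolution between `H_M = P H_A` and `P H_N = ∑ (-1)^i
  -- H_{Tor_i}`.
  have hmul : G.series * H.series =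
      (Gr.self 𝒜).series * ∑ i ∈ Finset.range (n + 2), (-1) ^ i * (T i).series := by
    rw [← h2, show G.series = _ from h1]
    ring
  obtain ⟨h3, h4, h5⟩ := hpM.compare hqN hrA hs hmul hp hq hr
  rw [hdM, hdN, hd]
  exact ⟨by exact_mod_cast h3, h4, h5.trans (by norm_cast)⟩
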